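/- **Lemma (local compatibility condition).** For each $n$, let $(X_i,T_i)_{i=1}^n$ be i.i.d. copies of a pair $(X,T)$, where $T$ is real valued and $X$ takes values in a measurable space; the law of $(X,T)$ and all quantities with index $n$ below may depend on $n$. Write $\|g\|_{P_n,2}=(n^{-1}\sum_{i\le n} g_i^2)^{1/2}$ for the empirical $L^2$ norm. For a vector $\delta\in\mathbb R^{p}$ let $\|\delta\|_0$ be the number of its nonzero coordinates, and for $S\subset\{1,\dots,p\}$ let $\delta_S$ be the vector that agrees with $\delta$ on $S$ and vanishes on $S^c$. "W.p.a.1" means with probability tending to one as $n\to\infty$. Assume: 1. (Kernel and bandwidth) $K$ is a bounded symmetric probability density on $\mathbb R$ with compact support, $\int uK(u)\,du=0$, $\int u^2K(u)\,du<\infty$, $\sup_u u^lK(u)<\infty$ for $l=0,1$, and $K$ is continuous at Lebesgue-almost every point. The bandwidths satisfy $h=h_n>0$ and $h_n\to0$. 2. (Overlap) $\mathcal T\subset\mathbb R$ is compact, $T$ has a jointly measurable conditional density $f_t(x)$ given $X=x$, and there are a constant $0<\underline C<1$ and a compact set $\mathcal T'$ with $\mathcal T$ in its interior, both independent of $n$,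 such that for every $t\in\mathcal T'$, $\underline C\le f_t(X)\le 1/\underline C$ almost surely. 3. (Basis functions and rates) $b(x)=(b_1(x),\dots,b_p(x))'$ with $p=p_n$ measurable functions, $\max_{j\le p}|b_j(X)|\le\zeta_n$ almost surely, $\underline C\le \mathbb E\,b_j(X)^2\le 1/\underline C$ for all $j\le p$, and $\zeta_n^2s^2\ell_n^2\log(p\vee n)/(nh)\to0$ for some $\ell_n\to\infty$ and sparsity levels $s=s_n\in\mathbb N$. 4. (Sparse eigenvalues) There are constants $0<\kappa'\le\kappa''<\infty$ independent of $n$ and a sequence $\tilde\ell_n\to\infty$ (for example $\tilde\ell_n=\ell_n$) such that w.p.a.1 $$\kappa'\le \frac{\|b(X)'\delta\|_{P_n,2}}{\|\delta\|_2}\le\kappa''\qquad\text{for all }\delta\ne0\text{ with }\|\delta\|_0\le s\tilde\ell_n .$$ Let $\mathcal U\subset\mathbb R$, and for $(t,u)\in\mathcal T\times\mathcal U$ let $\mathcal S_{t,u}\subset\{1,\dots,p\}$ be arbitrary (nonrandom, possibly depending on $n$) with $\sup_{(t,u)}|\mathcal S_{t,u}|\le s$. For a finite constant $c$ independent of $(t,u)$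 and $n$, let $\Delta_{c,t,u}=\{\delta\in\mathbb R^p:\|\delta_{\mathcal S_{t,u}^c}\|_1\le c\,\|\delta_{\mathcal S_{t,u}}\|_1\}$. Then $\underline\kappa:=\kappa'\underline C^{1/2}/4>0$ and, w.p.a.1, $$\inf_{(t,u)\in\mathcal T\times\mathcal U}\ \inf_{\delta\in\Delta_{c,t,u},\ \delta_{\mathcal S_{t,u}}\neq0}\ \frac{\big\|b(X)'\delta\,K\big(\tfrac{T-t}{h}\big)^{1/2}\big\|_{P_n,2}}{\|\delta_{\mathcal S_{t,u}}\|_2\sqrt h}\ \ge\ \underline\kappa ,$$ where an infimum over the empty set is $+\infty$. -/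

import Mathlib

open MeasureTheory ProbabilityTheory Filter Topology

/-- "With probability approaching one": the probabilities of the complements tend to zero.
(For events that are not known to be measurable, this is a statement about outer measures
of the complements.) -/
def WPA1 {Ω : ℕ → Type*} [∀ n, MeasurableSpace (Ω n)] (μ : ∀ n, Measure (Ω n))
    (E : ∀ n, Set (Ω n)) : Prop :=
  Tendsto (fun n => μ n (E n)ᶜ) atTop (𝓝 0)

/-- The `ℓ¹` norm of a real vector. -/
noncomputable def l1Norm {p : ℕ} (v : Fin p → ℝ) : ℝ := ‖WithLp.toLp 1 v‖

/-- The `ℓ²` (Euclidean) norm of a real vector. -/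
noncomputable def l2Norm {p : ℕ} (v : Fin p → ℝ) : ℝ := ‖WithLp.toLp 2 v‖

/-- The vector `δ_S`, equal to `δ` on the coordinates in `S` and zero on the others. -/
noncomputable def restrictTo {p : ℕ} (S : Finset (Fin p)) (δ : Fin p → ℝ) : Fin p → ℝ :=
  Set.indicator (S : Set (Fin p)) δ

/-- The empirical norm `‖g‖_{P_n,2} = (n⁻¹ ∑ᵢ gᵢ²)^{1/2}` of the values `gᵢ` of a function at the
`n` observations. -/
noncomputable def empNorm {n : ℕ} (g : Fin n → ℝ) : ℝ := √((∑ i, g i ^ 2) / (n : ℝ))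

/-- The linear form `b(x)'δ`, where `b` is a vector of `p` basis functions. -/
def linForm {𝒳 : Type*} {p : ℕ} (b : Fin p → 𝒳 → ℝ) (δ : Fin p → ℝ) (x : 𝒳) : ℝ :=
  ∑ j, b j x * δ j

/-- The cone `{δ : ‖δ_{Sᶜ}‖₁ ≤ c ‖δ_S‖₁}`. -/
def cone {p : ℕ} (c : ℝ) (S : Finset (Fin p)) : Set (Fin p → ℝ) :=
  {δ | l1Norm (restrictTo Sᶜ δ) ≤ c * l1Norm (restrictTo S δ)}

/-- `(X i, T i)`, `i = 1, …, n`, are i.i.d. with common law `P`. -/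
structure IsIIDSample {Ω 𝒳 : Type*} [MeasurableSpace Ω] [MeasurableSpace 𝒳] {n : ℕ}
    (μ : Measure Ω) (P : Measure (𝒳 × ℝ)) (X : Fin n → Ω → 𝒳) (T : Fin n → Ω → ℝ) : Prop where
  measurable_X : ∀ i, Measurable (X i)
  measurable_T : ∀ i, Measurable (T i)
  indep : iIndepFun (fun i ω => (X i ω, T i ω)) μ
  law : ∀ i, μ.map (fun ω => (X i ω, T i ω)) = P

/-- `f t x` is a (jointly measurable version of the) conditional density at `t` of the second
coordinate `T` given the first coordinate `X = x`, when `(X, T)` has law `P`. -/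
structure IsCondDensity {𝒳 : Type*} [MeasurableSpace 𝒳] (P : Measure (𝒳 × ℝ))
    (f : ℝ → 𝒳 → ℝ) : Prop where
  measurable : Measurable (fun z : 𝒳 × ℝ => f z.2 z.1)
  nonneg : ∀ t x, 0 ≤ f t x
  law : P = (P.fst.prod volume).withDensity (fun z => ENNReal.ofReal (f z.2 z.1))

/-- A symmetric kernel: a bounded, compactly supported, symmetric probability density with
`∫ u K(u) du = 0`, finite second moment, and `sup_u u^l K(u) < ∞` for `l = 0, 1`, which is
continuous at almost every point (equivalently, as it is bounded with compact support,
Riemann integrable). -/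
structure IsSymmKernel (K : ℝ → ℝ) : Prop where
  measurable : Measurable K
  nonneg : ∀ u, 0 ≤ K u
  integrable : Integrable K
  integral_eq_one : ∫ u, K u = 1
  symm : ∀ u, K (-u) = K u
  compactSupport : HasCompactSupport K
  first_moment : ∫ u, u * K u = 0
  second_moment : Integrable (fun u => u ^ 2 * K u)
  bounded : ∃ C : ℝ, 0 < C ∧ ∀ u, K u ≤ C ∧ u * K u ≤ C
  ae_continuousAt : ∀ᵐ u, ContinuousAt K u

/-- The basis functions are bounded by `ζ` in sup norm, almost surely, and have second
moments in `[C, 1/C]`; here `Q` is the law of the covariates `X`. -/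
structure BasisBounds {𝒳 : Type*} [MeasurableSpace 𝒳] {p : ℕ} (Q : Measure 𝒳)
    (b : Fin p → 𝒳 → ℝ) (ζ C : ℝ) : Prop where
  measurable : ∀ j, Measurable (b j)
  sup_le : ∀ᵐ x ∂Q, ∀ j, |b j x| ≤ ζ
  le_moment : ∀ j, C ≤ ∫ x, b j x ^ 2 ∂Q
  moment_le : ∀ j, ∫ x, b j x ^ 2 ∂Q ≤ 1 / C

/-- The sparse eigenvalue condition: for some `ℓ_n → ∞`, with probability approaching one,
`κ₁ ≤ ‖b(X)'δ‖_{P_n,2} / ‖δ‖₂ ≤ κ₂` for all `δ ≠ 0` with `‖δ‖₀ ≤ s_n ℓ_n`. -/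
def SparseEigenvalueCondition {Ω 𝒳 : ℕ → Type*} [∀ n, MeasurableSpace (Ω n)]
    (μ : ∀ n, Measure (Ω n)) (p s : ℕ → ℕ) (b : ∀ n, Fin (p n) → 𝒳 n → ℝ)
    (X : ∀ n, Fin n → Ω n → 𝒳 n) (κ₁ κ₂ : ℝ) : Prop :=
  ∃ ℓ : ℕ → ℝ, Tendsto ℓ atTop atTop ∧
    WPA1 μ (fun n => {ω | ∀ δ : Fin (p n) → ℝ, δ ≠ 0 → (hammingNorm δ : ℝ) ≤ s n * ℓ n →
      κ₁ ≤ empNorm (fun i => linForm (b n) δ (X n i ω)) / l2Norm δ ∧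
      empNorm (fun i => linForm (b n) δ (X n i ω)) / l2Norm δ ≤ κ₂})

/-! ### Norms of restricted vectors. -/

section Vectors

variable {p : ℕ}

/-! After division by `h`, the squared weighted norm has weights `K ((T i - t) / h) / h`. By overlap
their conditional mean given the covariates is of order one. The weighted Gram form should therefore
dominate a multiple of the unweighted one, for which the sparse eigenvalue bounds give the
restricted eigenvalue `κ₁ / 2` on the cone (`empNorm_ge_of_sparse`, by peeling off blocks of
coordinates in decreasing order of size). What remains is uniformity in `t` and the fluctuation of
the weights.

Uniformity is needed only from below, so `K` is replaced by its infimum over balls of radius `ε`,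
centred on a grid of mesh `ε * h`. One such weight minorises the kernel weights of all `t` within
one mesh of its grid point (`lowerWeight_le`), so `O(1 / h)` points suffice and no smoothness of `K`
is needed. Since `K` is continuous almost everywhere, a small `ε` keeps half of its mass
(`exists_half_le_integral_localInf`), and the conditional mean `g` of the weight is at least `C /
2`.

For the fluctuation, the weights are centred at `g (X i)` rather than at a full expectation, so the
population Gram matrix never enters. Bernstein's inequality (`measureReal_gram_deviation_le`) and a
union bound over matrix entries and grid points keep every entry of the deviation matrix below `η /
s`. On the cone `‖δ‖₁² ≤ (1 + |c|)² s ‖δ_S‖₂²`, so the quadratic form moves by at most a small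
multiple of `‖δ_S‖₂²` (`weighted_empNorm_ge`). The exceptional events involve neither `u` nor the
sets `S t u`, which gives uniformity over them for free. -/

theorem restrictTo_apply (S : Finset (Fin p)) (δ : Fin p → ℝ) (i : Fin p) :
    restrictTo S δ i = if i ∈ S then δ i else 0 := by
  simp [restrictTo, Set.indicator_apply]

theorem l1Norm_eq_sum (v : Fin p → ℝ) : l1Norm v = ∑ i, |v i| := by
  simp [l1Norm, PiLp.norm_eq_of_L1]

theorem l2Norm_eq_sqrt (v : Fin p → ℝ) : l2Norm v = √(∑ i, v i ^ 2) := by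
  simp [l2Norm, EuclideanSpace.norm_eq]

theorem l1Norm_restrictTo (S : Finset (Fin p)) (δ : Fin p → ℝ) :
    l1Norm (restrictTo S δ) = ∑ i ∈ S, |δ i| := by
  simp [l1Norm_eq_sum, restrictTo_apply, apply_ite abs]

theorem l2Norm_restrictTo (S : Finset (Fin p)) (δ : Fin p → ℝ) :
    l2Norm (restrictTo S δ) = √(∑ i ∈ S, δ i ^ 2) := by
  simp [l2Norm_eq_sqrt, restrictTo_apply, ite_pow]

theorem l2Norm_nonneg (v : Fin p → ℝ) : 0 ≤ l2Norm v := norm_nonneg _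

theorem l2Norm_pos {v : Fin p → ℝ} (hv : v ≠ 0) : 0 < l2Norm v := by
  rw [l2Norm, norm_pos_iff]
  simpa using hv

theorem hammingNorm_restrictTo_le (S : Finset (Fin p)) (δ : Fin p → ℝ) :
    hammingNorm (restrictTo S δ) ≤ S.card := by
  refine Finset.card_le_card fun i hi => ?_
  by_contra h
  simp [restrictTo_apply, h] at hi

theorem restrictTo_union_of_disjoint {S R : Finset (Fin p)} (h : Disjoint S R)
    (δ : Fin p → ℝ) : restrictTo (S ∪ R) δ = restrictTo S δ + restrictTo R δ := by
  ext i
  have : i ∈ S → i ∉ R := fun hi => Finset.disjoint_left.1 h hi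
  by_cases h1 : i ∈ S <;> by_cases h2 : i ∈ R <;> simp_all [restrictTo_apply]

theorem restrictTo_univ (δ : Fin p → ℝ) : restrictTo Finset.univ δ = δ := by
  ext i; simp [restrictTo_apply]

/-- Cauchy–Schwarz; this is the source of every factor `√s` on the cone. -/
theorem sum_abs_le_sqrt_mul_sqrt {ι : Type*} (S : Finset ι) (δ : ι → ℝ) {s : ℕ}
    (hs : S.card ≤ s) : ∑ i ∈ S, |δ i| ≤ √s * √(∑ i ∈ S, δ i ^ 2) := by
  rw [← Real.sqrt_mul (by positivity)]
  apply Real.le_sqrt_of_sq_le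
  calc (∑ i ∈ S, |δ i|) ^ 2 ≤ S.card * ∑ i ∈ S, |δ i| ^ 2 := sq_sum_le_card_mul_sum_sq
    _ ≤ s * ∑ i ∈ S, δ i ^ 2 := by
      simp only [sq_abs]
      gcongr

/-! ### From sparse to restricted eigenvalues. -/

/-- A finite set contains a subset of any admissible size on which a function is largest. -/
theorem exists_subset_card_eq_forall_le {ι : Type*} [DecidableEq ι] (A : Finset ι) (v : ι → ℝ)
    (m : ℕ) (hm : m ≤ A.card) :
    ∃ B ⊆ A, B.card = m ∧ ∀ i ∈ B, ∀ j ∈ A \ B, v j ≤ v i := by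
  induction m with
  | zero => exact ⟨∅, by simp, by simp, by simp⟩
  | succ m ih =>
    obtain ⟨B, hBA, hB, hle⟩ := ih (by omega)
    have hne : (A \ B).Nonempty := by
      rw [← Finset.card_pos, Finset.card_sdiff_of_subset hBA]; omega
    obtain ⟨a, ha, hmax⟩ := Finset.exists_max_image (A \ B) v hne
    have ha' := Finset.mem_sdiff.1 ha
    refine ⟨insert a B, Finset.insert_subset ha'.1 hBA, by simp [ha'.2, hB], ?_⟩
    intro i hi j hj
    have hj' : j ∈ A \ B := by
      simp only [Finset.mem_sdiff, Finset.mem_insert, not_or] at hj ⊢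
      exact ⟨hj.1, hj.2.2⟩
    rcases Finset.mem_insert.1 hi with rfl | hi
    · exact hmax j hj'
    · exact hle i hi j hj'

/-- The same, with a threshold separating the values inside and outside of the subset;
the threshold is at most the average of the values in the subset. -/
theorem exists_subset_card_eq_threshold {ι : Type*} [DecidableEq ι] (A : Finset ι) (v : ι → ℝ)
    {m : ℕ} (hm0 : 0 < m) (hm : m ≤ A.card) :
    ∃ B ⊆ A, B.card = m ∧ ∃ M, (∀ j ∈ A \ B, |v j| ≤ M) ∧ m * M ≤ ∑ i ∈ B, |v i| := by
  obtain ⟨B, hBA, hB, hle⟩ := exists_subset_card_eq_forall_le A (fun i => |v i|) m hm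
  have hne : B.Nonempty := by rw [← Finset.card_pos]; omega
  obtain ⟨a, ha, hmin⟩ := Finset.exists_min_image B (fun i => |v i|) hne
  refine ⟨B, hBA, hB, |v a|, fun j hj => hle a ha j hj, ?_⟩
  have := Finset.card_nsmul_le_sum B (fun i => |v i|) |v a| hmin
  simpa [hB] using this

/-- A seminorm that is controlled by the Euclidean norm on `m`-sparse vectors is controlled by
the sup norm and the `ℓ¹` norm on all vectors. -/
theorem seminorm_restrictTo_le_of_sparse (F : Seminorm ℝ (Fin p → ℝ)) {m : ℕ} (hm : 0 < m)
    {κ : ℝ} (hκ : 0 ≤ κ) (hF : ∀ v, hammingNorm v ≤ m → F v ≤ κ * l2Norm v)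
    (v : Fin p → ℝ) (A : Finset (Fin p)) (M : ℝ) (hM0 : 0 ≤ M) (hM : ∀ i ∈ A, |v i| ≤ M) :
    F (restrictTo A v) ≤ κ * (√m * M + (∑ i ∈ A, |v i|) / √m) := by
  have hm' : (0 : ℝ) < √m := by positivity
  have small : ∀ (B : Finset (Fin p)) (M : ℝ), 0 ≤ M → (∀ i ∈ B, |v i| ≤ M) → B.card ≤ m →
      F (restrictTo B v) ≤ κ * (√m * M) := by
    intro B M hM0 hM hB
    refine (hF _ ((hammingNorm_restrictTo_le B v).trans hB)).trans ?_
    gcongr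
    rw [l2Norm_restrictTo]
    apply Real.sqrt_le_iff.2 ⟨by positivity, ?_⟩
    rw [mul_pow, Real.sq_sqrt (by positivity)]
    calc ∑ i ∈ B, v i ^ 2 ≤ B.card • M ^ 2 :=
          Finset.sum_le_card_nsmul _ _ _ fun i hi => by
            rw [← sq_abs]; exact pow_le_pow_left₀ (abs_nonneg _) (hM i hi) 2
      _ ≤ m * M ^ 2 := by rw [nsmul_eq_mul]; gcongr
  -- Peel off the `m` largest entries `B`. The remaining entries are bounded by a threshold `M'`
  -- with `√m * M' ≤ ‖v_B‖₁ / √m`, so the sup term of the rest is paid for by the `ℓ¹` mass of the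
  -- removed block, and the sum telescopes.
  induction hA : A.card using Nat.strong_induction_on generalizing A M with
  | _ k ih =>
    by_cases hk : A.card ≤ m
    · refine (small A M hM0 hM hk).trans ?_
      gcongr
      have : 0 ≤ (∑ i ∈ A, |v i|) / √m := by positivity
      linarith
    · push Not at hk
      obtain ⟨B, hBA, hB, M', hM', hsum⟩ := exists_subset_card_eq_threshold A v hm hk.le
      have hcard : (A \ B).card = A.card - m := by rw [Finset.card_sdiff_of_subset hBA, hB]
      have hM'0 : 0 ≤ M' := by
        obtain ⟨j, hj⟩ : (A \ B).Nonempty := by rw [← Finset.card_pos]; omega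
        exact (abs_nonneg _).trans (hM' j hj)
      have h1 := small B M hM0 (fun i hi => hM i (hBA hi)) hB.le
      have h2 := ih (A \ B).card (by omega) (A \ B) M' hM'0 hM' rfl
      have h3 : F (restrictTo A v) ≤ F (restrictTo B v) + F (restrictTo (A \ B) v) := by
        rw [← Finset.union_sdiff_of_subset hBA,
          restrictTo_union_of_disjoint Finset.disjoint_sdiff, Finset.union_sdiff_of_subset hBA]
        exact map_add_le_add F _ _
      have h4 : √m * M' ≤ (∑ i ∈ B, |v i|) / √m := by
        rw [le_div_iff₀ hm']
        calc √m * M' * √m = (√m * √m) * M' := by ring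
          _ ≤ _ := by rw [Real.mul_self_sqrt (by positivity)]; exact hsum
      have h5 : ∑ i ∈ A, |v i| = ∑ i ∈ A \ B, |v i| + ∑ i ∈ B, |v i| :=
        (Finset.sum_sdiff hBA).symm
      calc F (restrictTo A v)
          ≤ κ * (√m * M) + κ * (√m * M' + (∑ i ∈ A \ B, |v i|) / √m) := by linarith
        _ = κ * (√m * M + (√m * M' + (∑ i ∈ A \ B, |v i|) / √m)) := by ring
        _ ≤ κ * (√m * M + (∑ i ∈ A, |v i|) / √m) := by
          gcongr
          rw [h5, add_div]
          linarith

/-- Sparse eigenvalue bounds imply a restricted eigenvalue bound. -/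
theorem seminorm_ge_of_sparse (F : Seminorm ℝ (Fin p → ℝ)) {m s : ℕ} (hm : 0 < m)
    {κ₁ κ₂ : ℝ} (hκ₁ : 0 ≤ κ₁) (hκ₂ : 0 ≤ κ₂)
    (hlow : ∀ v, hammingNorm v ≤ s + m → κ₁ * l2Norm v ≤ F v)
    (hup : ∀ v, hammingNorm v ≤ s + m → F v ≤ κ₂ * l2Norm v)
    (S : Finset (Fin p)) (hS : S.card ≤ s) (δ : Fin p → ℝ) :
    κ₁ * l2Norm (restrictTo S δ) - κ₂ * (l1Norm (restrictTo Sᶜ δ) / √m) ≤ F δ := by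
  have hm' : (0 : ℝ) < √m := by positivity
  have mono : ∀ B : Finset (Fin p), l2Norm (restrictTo S δ) ≤ l2Norm (restrictTo (S ∪ B) δ) := by
    intro B
    rw [l2Norm_restrictTo, l2Norm_restrictTo]
    exact Real.sqrt_le_sqrt
      (Finset.sum_le_sum_of_subset_of_nonneg Finset.subset_union_left fun _ _ _ => sq_nonneg _)
  have sparse : ∀ B : Finset (Fin p), B.card ≤ m →
      κ₁ * l2Norm (restrictTo S δ) ≤ F (restrictTo (S ∪ B) δ) := by
    intro B hB
    refine (mul_le_mul_of_nonneg_left (mono B) hκ₁).trans (hlow _ ?_)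
    exact (hammingNorm_restrictTo_le _ _).trans ((Finset.card_union_le S B).trans (by omega))
  rw [l1Norm_restrictTo]
  by_cases hk : Sᶜ.card ≤ m
  · have h1 := sparse Sᶜ hk
    rw [Finset.union_compl, restrictTo_univ] at h1
    have : 0 ≤ κ₂ * ((∑ i ∈ Sᶜ, |δ i|) / √m) := by positivity
    linarith
  · push Not at hk
    -- The `m` largest coordinates outside `S` join the head `S ∪ B`, which is still sparse; their
    -- `ℓ¹` mass then pays for the sup norm of the tail.
    obtain ⟨B, hBA, hB, M, hM, hsum⟩ := exists_subset_card_eq_threshold Sᶜ δ hm hk.le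
    have hM0 : 0 ≤ M := by
      obtain ⟨j, hj⟩ : (Sᶜ \ B).Nonempty := by
        rw [← Finset.card_pos, Finset.card_sdiff_of_subset hBA]; omega
      exact (abs_nonneg _).trans (hM j hj)
    have h1 := sparse B hB.le
    have h2 := seminorm_restrictTo_le_of_sparse F hm hκ₂ (fun v hv => hup v (by omega)) δ
      (Sᶜ \ B) M hM0 hM
    have hdec : restrictTo (S ∪ B) δ = δ - restrictTo (Sᶜ \ B) δ := by
      ext i
      by_cases h1 : i ∈ S <;> by_cases h2 : i ∈ B <;> simp [restrictTo_apply, h1, h2]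
    have h3 : F (restrictTo (S ∪ B) δ) ≤ F δ + F (restrictTo (Sᶜ \ B) δ) := by
      rw [hdec]; exact map_sub_le_add F _ _
    have h4 : √m * M ≤ (∑ i ∈ B, |δ i|) / √m := by
      rw [le_div_iff₀ hm']
      calc √m * M * √m = (√m * √m) * M := by ring
        _ ≤ _ := by rw [Real.mul_self_sqrt (by positivity)]; exact hsum
    have h5 : ∑ i ∈ Sᶜ, |δ i| = ∑ i ∈ Sᶜ \ B, |δ i| + ∑ i ∈ B, |δ i| :=
      (Finset.sum_sdiff hBA).symm
    have h6 : κ₂ * (√m * M + (∑ i ∈ Sᶜ \ B, |δ i|) / √m) ≤ κ₂ * ((∑ i ∈ Sᶜ, |δ i|) / √m) := by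
      gcongr
      rw [h5, add_div]
      linarith
    linarith

/-- The empirical norm of a linear form, as a seminorm on the coefficients. -/
noncomputable def empSeminorm {𝒳 : Type*} {n : ℕ} (b : Fin p → 𝒳 → ℝ) (x : Fin n → 𝒳) :
    Seminorm ℝ (Fin p → ℝ) :=
  (normSeminorm ℝ (EuclideanSpace ℝ (Fin n))).comp
    (show (Fin p → ℝ) →ₗ[ℝ] EuclideanSpace ℝ (Fin n) from
    { toFun := fun δ => WithLp.toLp 2 fun i => linForm b δ (x i) / √n
      map_add' := fun δ δ' => by
        ext i
        simp [linForm, mul_add, Finset.sum_add_distrib, add_div]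
      map_smul' := fun a δ => by
        ext i
        simp [linForm, Finset.mul_sum, Finset.sum_div]
        refine Finset.sum_congr rfl fun j _ => by ring })

theorem empSeminorm_apply {𝒳 : Type*} {n : ℕ} (b : Fin p → 𝒳 → ℝ) (x : Fin n → 𝒳)
    (δ : Fin p → ℝ) : empSeminorm b x δ = empNorm fun i => linForm b δ (x i) := by
  simp [empSeminorm, empNorm, EuclideanSpace.norm_eq, div_pow, Finset.sum_div]

/-- The restricted eigenvalue bound for the empirical norm on a cone. -/
theorem empNorm_ge_of_sparse {𝒳 : Type*} {n : ℕ} (b : Fin p → 𝒳 → ℝ) (x : Fin n → 𝒳)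
    {s L : ℕ} {κ₁ κ₂ c r : ℝ} (hs : 0 < s) (hL : 0 < L) (hκ₁ : 0 < κ₁) (hr : (L + 1 : ℝ) ≤ r)
    (hL' : max κ₂ 0 * |c| ≤ κ₁ / 2 * √L)
    (hsp : ∀ δ : Fin p → ℝ, δ ≠ 0 → (hammingNorm δ : ℝ) ≤ s * r →
      κ₁ ≤ empNorm (fun i => linForm b δ (x i)) / l2Norm δ ∧
      empNorm (fun i => linForm b δ (x i)) / l2Norm δ ≤ κ₂)
    (S : Finset (Fin p)) (hS : S.card ≤ s) (δ : Fin p → ℝ) (hδ : δ ∈ cone c S) :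
    κ₁ / 2 * l2Norm (restrictTo S δ) ≤ empNorm fun i => linForm b δ (x i) := by
  -- Blocks of size `s * L`: head and block together have at most `s * (L + 1) ≤ s * r` nonzero
  -- coordinates.
  have hm : 0 < s * L := Nat.mul_pos hs hL
  have hsp' : ∀ v : Fin p → ℝ, v ≠ 0 → hammingNorm v ≤ s + s * L →
      κ₁ * l2Norm v ≤ empSeminorm b x v ∧ empSeminorm b x v ≤ κ₂ * l2Norm v := by
    intro v hv hle
    have h1 : (hammingNorm v : ℝ) ≤ s * r := by
      calc (hammingNorm v : ℝ) ≤ ((s + s * L : ℕ) : ℝ) := by exact_mod_cast hle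
        _ = s * (L + 1) := by push_cast; ring
        _ ≤ s * r := by gcongr
    have h2 := hsp v hv h1
    rw [le_div_iff₀ (l2Norm_pos hv), div_le_iff₀ (l2Norm_pos hv)] at h2
    rw [empSeminorm_apply]
    exact h2
  have hzero : l2Norm (0 : Fin p → ℝ) = 0 := by simp [l2Norm]
  -- The sign of `κ₂` is not known a priori (for `p = 0` the eigenvalue condition is vacuous), hence
  -- `max κ₂ 0`.
  have key := seminorm_ge_of_sparse (empSeminorm b x) (s := s) hm hκ₁.le (le_max_right κ₂ 0)
    (fun v hv => by
      rcases eq_or_ne v 0 with rfl | h0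
      · simp [hzero]
      · exact (hsp' v h0 hv).1)
    (fun v hv => by
      rcases eq_or_ne v 0 with rfl | h0
      · simp [hzero]
      · exact (hsp' v h0 hv).2.trans
          (mul_le_mul_of_nonneg_right (le_max_left _ _) (l2Norm_nonneg v)))
    S hS δ
  rw [empSeminorm_apply] at key
  set N := l2Norm (restrictTo S δ) with hN
  have hN0 : 0 ≤ N := l2Norm_nonneg _
  have h1 : l1Norm (restrictTo Sᶜ δ) ≤ |c| * (√s * N) := by
    have h2 : l1Norm (restrictTo Sᶜ δ) ≤ c * l1Norm (restrictTo S δ) := hδ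
    have h3 : l1Norm (restrictTo S δ) ≤ √s * N := by
      rw [hN, l1Norm_restrictTo, l2Norm_restrictTo]
      exact sum_abs_le_sqrt_mul_sqrt S δ hS
    have h4 : 0 ≤ l1Norm (restrictTo S δ) := norm_nonneg _
    calc _ ≤ c * l1Norm (restrictTo S δ) := h2
      _ ≤ |c| * l1Norm (restrictTo S δ) := by gcongr; exact le_abs_self c
      _ ≤ _ := by gcongr
  -- The `√s` from Cauchy–Schwarz cancels against `√(s * L)`; the choice of `L` makes the tail cost
  -- at most half of `κ₁`.
  have h2 : max κ₂ 0 * (l1Norm (restrictTo Sᶜ δ) / √(s * L : ℕ)) ≤ κ₁ / 2 * N := by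
    have hs' : (0 : ℝ) < √s := by positivity
    have hL'' : (0 : ℝ) < √L := by positivity
    calc max κ₂ 0 * (l1Norm (restrictTo Sᶜ δ) / √(s * L : ℕ))
        ≤ max κ₂ 0 * (|c| * (√s * N) / √(s * L : ℕ)) := by gcongr
      _ = (max κ₂ 0 * |c|) * N / √L := by
        push_cast
        rw [Real.sqrt_mul (by positivity)]
        field_simp
      _ ≤ (κ₁ / 2 * √L) * N / √L := by gcongr
      _ = κ₁ / 2 * N := by field_simp
  linarith

/-! ### Weighted Gram forms on the cone. -/

/-- A quadratic form is bounded by its largest coefficient times the squared `ℓ¹` norm. -/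
theorem abs_quadForm_le {ι : Type*} (A : Finset ι) (D : ι → ι → ℝ) {τ : ℝ}
    (hD : ∀ j ∈ A, ∀ l ∈ A, |D j l| ≤ τ) (δ : ι → ℝ) :
    |∑ j ∈ A, ∑ l ∈ A, D j l * (δ j * δ l)| ≤ τ * (∑ j ∈ A, |δ j|) ^ 2 := by
  calc |∑ j ∈ A, ∑ l ∈ A, D j l * (δ j * δ l)|
      ≤ ∑ j ∈ A, ∑ l ∈ A, |D j l * (δ j * δ l)| :=
        (Finset.abs_sum_le_sum_abs _ _).trans
          (Finset.sum_le_sum fun j _ => Finset.abs_sum_le_sum_abs _ _)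
    _ ≤ ∑ j ∈ A, ∑ l ∈ A, τ * (|δ j| * |δ l|) := by
        refine Finset.sum_le_sum fun j hj => Finset.sum_le_sum fun l hl => ?_
        rw [abs_mul, abs_mul]
        exact mul_le_mul_of_nonneg_right (hD j hj l hl) (by positivity)
    _ = τ * (∑ j ∈ A, |δ j|) ^ 2 := by
        rw [sq, Finset.sum_mul_sum, Finset.mul_sum]
        simp_rw [Finset.mul_sum]

/-- On the cone, a lower bound for the weighted empirical norm follows from the restricted
eigenvalue bound, when the Gram matrices for the weights `w` and `g` are close entrywise. -/
theorem weighted_empNorm_ge {𝒳 : Type*} {n : ℕ} (b : Fin p → 𝒳 → ℝ) (x : Fin n → 𝒳)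
    {s : ℕ} {κ C τ c h : ℝ} (hκ : 0 < κ) (hC : 0 < C) (hh : 0 < h)
    (S : Finset (Fin p)) (hS : S.card ≤ s) (δ : Fin p → ℝ) (hδ : δ ∈ cone c S)
    (hδS : restrictTo S δ ≠ 0)
    (hre : κ / 2 * l2Norm (restrictTo S δ) ≤ empNorm fun i => linForm b δ (x i))
    (k w g : Fin n → ℝ) (hk : ∀ i, 0 ≤ k i) (hwk : ∀ i, w i ≤ k i / h) (hg : ∀ i, C / 2 ≤ g i)
    (hτ0 : 0 ≤ τ) (hτ : τ * ((1 + |c|) ^ 2 * s) ≤ κ ^ 2 * C / 16)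
    (hdev : ∀ j l, |(∑ i, b j (x i) * b l (x i) * (w i - g i)) / n| ≤ τ) :
    κ * √C / 4 ≤ empNorm (fun i => linForm b δ (x i) * √(k i)) /
      (l2Norm (restrictTo S δ) * √h) := by
  set N := l2Norm (restrictTo S δ) with hN
  have hN0 : 0 < N := l2Norm_pos hδS
  have hl1 : ∑ j, |δ j| ≤ (1 + |c|) * (√s * N) := by
    have h2 : l1Norm (restrictTo Sᶜ δ) ≤ c * l1Norm (restrictTo S δ) := hδ
    rw [l1Norm_restrictTo, l1Norm_restrictTo] at h2
    have h3 : ∑ i ∈ S, |δ i| ≤ √s * N := by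
      rw [hN, l2Norm_restrictTo]
      exact sum_abs_le_sqrt_mul_sqrt S δ hS
    have h4 : 0 ≤ ∑ i ∈ S, |δ i| := by positivity
    have h5 : c * ∑ i ∈ S, |δ i| ≤ |c| * ∑ i ∈ S, |δ i| := by gcongr; exact le_abs_self c
    rw [← Finset.sum_add_sum_compl S]
    calc _ ≤ (1 + |c|) * ∑ i ∈ S, |δ i| := by linarith
      _ ≤ _ := by gcongr
  have hquad : (∑ i, linForm b δ (x i) ^ 2 * (w i - g i)) / n =
      ∑ j, ∑ l, (∑ i, b j (x i) * b l (x i) * (w i - g i)) / n * (δ j * δ l) := by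
    have : ∀ i, linForm b δ (x i) ^ 2 * (w i - g i) =
        ∑ j, ∑ l, b j (x i) * b l (x i) * (w i - g i) * (δ j * δ l) := by
      intro i
      rw [linForm, sq, Finset.sum_mul_sum, Finset.sum_mul]
      refine Finset.sum_congr rfl fun j _ => ?_
      rw [Finset.sum_mul]
      refine Finset.sum_congr rfl fun l _ => by ring
    simp_rw [this, Finset.sum_div, Finset.sum_mul]
    rw [Finset.sum_comm]
    refine Finset.sum_congr rfl fun j _ => ?_
    rw [Finset.sum_comm]
    refine Finset.sum_congr rfl fun l _ => Finset.sum_congr rfl fun i _ => by ring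
  have hdev' : -(κ ^ 2 * C / 16 * N ^ 2) ≤
      (∑ i, linForm b δ (x i) ^ 2 * (w i - g i)) / n := by
    rw [hquad]
    refine le_trans ?_ (abs_le.1 (abs_quadForm_le Finset.univ _ (τ := τ)
      (fun j _ l _ => hdev j l) δ)).1
    refine neg_le_neg ?_
    calc τ * (∑ j, |δ j|) ^ 2 ≤ τ * ((1 + |c|) * (√s * N)) ^ 2 := by
          gcongr
      _ = τ * ((1 + |c|) ^ 2 * s) * N ^ 2 := by
          rw [mul_pow, mul_pow, Real.sq_sqrt (by positivity)]; ring
      _ ≤ _ := by gcongr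
  have hmain : κ ^ 2 / 4 * N ^ 2 ≤ (∑ i, linForm b δ (x i) ^ 2) / n := by
    have h1 := pow_le_pow_left₀ (by positivity) hre 2
    rw [empNorm, Real.sq_sqrt (by positivity)] at h1
    calc _ = (κ / 2 * N) ^ 2 := by ring
      _ ≤ _ := h1
  have hgg : C / 2 * ((∑ i, linForm b δ (x i) ^ 2) / n) ≤
      (∑ i, linForm b δ (x i) ^ 2 * g i) / n := by
    rw [← mul_div_assoc, Finset.mul_sum]
    refine div_le_div_of_nonneg_right (Finset.sum_le_sum fun i _ => ?_) (by positivity)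
    rw [mul_comm]
    exact mul_le_mul_of_nonneg_left (hg i) (sq_nonneg _)
  have hww : (∑ i, linForm b δ (x i) ^ 2 * w i) / n ≤
      (∑ i, (linForm b δ (x i) * √(k i)) ^ 2) / n / h := by
    have e : (∑ i, (linForm b δ (x i) * √(k i)) ^ 2) / n / h =
        (∑ i, (linForm b δ (x i) * √(k i)) ^ 2 / h) / n := by
      rw [div_right_comm, Finset.sum_div]
    rw [e]
    refine div_le_div_of_nonneg_right (Finset.sum_le_sum fun i _ => ?_) (by positivity)
    rw [mul_pow, Real.sq_sqrt (hk i), mul_div_assoc]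
    exact mul_le_mul_of_nonneg_left (hwk i) (sq_nonneg _)
  have hsplit : (∑ i, linForm b δ (x i) ^ 2 * (w i - g i)) / n =
      (∑ i, linForm b δ (x i) ^ 2 * w i) / n - (∑ i, linForm b δ (x i) ^ 2 * g i) / n := by
    simp_rw [mul_sub]
    rw [Finset.sum_sub_distrib, sub_div]
  rw [le_div_iff₀ (by positivity), empNorm]
  apply Real.le_sqrt_of_sq_le
  -- The main term is `C / 2 * (κ / 2) ^ 2 = κ ^ 2 * C / 8`; the deviation uses up half of it, and
  -- the other half is `(κ * √C / 4) ^ 2`.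
  have hfin : κ ^ 2 * C / 16 * N ^ 2 ≤ (∑ i, (linForm b δ (x i) * √(k i)) ^ 2) / n / h := by
    have : C / 2 * (κ ^ 2 / 4 * N ^ 2) ≤ C / 2 * ((∑ i, linForm b δ (x i) ^ 2) / n) := by gcongr
    have e : C / 2 * (κ ^ 2 / 4 * N ^ 2) =
      κ ^ 2 * C / 16 * N ^ 2 + κ ^ 2 * C / 16 * N ^ 2 := by ring
    linarith
  rw [le_div_iff₀ hh] at hfin
  calc (κ * √C / 4 * (N * √h)) ^ 2 = κ ^ 2 * (√C) ^ 2 / 16 * N ^ 2 * (√h) ^ 2 := by ring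
    _ = κ ^ 2 * C / 16 * N ^ 2 * h := by rw [Real.sq_sqrt hC.le, Real.sq_sqrt hh.le]
    _ ≤ _ := hfin

end Vectors

/-! ### Bernstein's inequality for i.i.d. samples. -/

section Bernstein

/-- A bound for the moment generating function of a bounded centred random variable. -/
theorem mgf_le_exp_of_abs_le {E : Type*} [MeasurableSpace E] {P : Measure E}
    [IsProbabilityMeasure P] {Y : E → ℝ} (hY : AEMeasurable Y P) {V a : ℝ}
    (hb : ∀ᵐ z ∂P, |Y z| ≤ V) (h0 : ∫ z, Y z ∂P = 0) (h2 : ∫ z, Y z ^ 2 ∂P ≤ V)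
    (ha : 0 ≤ a) (haV : a * V ≤ 1) : mgf Y P a ≤ Real.exp (a ^ 2 * V) := by
  have hi1 : Integrable Y P := Integrable.of_bound hY.aestronglyMeasurable V hb
  have hi2 : Integrable (fun z => Y z ^ 2) P := by
    refine Integrable.of_bound (hY.pow_const 2).aestronglyMeasurable (V ^ 2) ?_
    filter_upwards [hb] with z hz
    rw [Real.norm_eq_abs, abs_pow]
    exact pow_le_pow_left₀ (abs_nonneg _) hz 2
  -- `exp y ≤ 1 + y + y ^ 2` for `|y| ≤ 1`.
  have hpt : ∀ᵐ z ∂P, Real.exp (a * Y z) ≤ 1 + a * Y z + a ^ 2 * Y z ^ 2 := by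
    filter_upwards [hb] with z hz
    have h1 : |a * Y z| ≤ 1 := by
      rw [abs_mul, abs_of_nonneg ha]
      exact (mul_le_mul_of_nonneg_left hz ha).trans haV
    have := (abs_le.1 (Real.abs_exp_sub_one_sub_id_le h1)).2
    rw [mul_pow] at this
    linarith
  have hi3 : Integrable (fun z => 1 + a * Y z + a ^ 2 * Y z ^ 2) P :=
    ((integrable_const _).add (hi1.const_mul a)).add (hi2.const_mul _)
  calc mgf Y P a = ∫ z, Real.exp (a * Y z) ∂P := rfl
    _ ≤ ∫ z, (1 + a * Y z + a ^ 2 * Y z ^ 2) ∂P :=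
      integral_mono_of_nonneg (ae_of_all _ fun z => (Real.exp_pos _).le) hi3 hpt
    _ = 1 + a ^ 2 * ∫ z, Y z ^ 2 ∂P := by
      have e1 := integral_add (μ := P) (integrable_const (1 : ℝ)) (hi1.const_mul a)
      have e2 := integral_add (((integrable_const (1 : ℝ)).add (hi1.const_mul a)))
        (hi2.const_mul (a ^ 2))
      simp only [Pi.add_apply] at e2
      rw [e2, e1, integral_const_mul, integral_const_mul, h0]
      simp
    _ ≤ a ^ 2 * V + 1 := by
      rw [add_comm]; gcongr
    _ ≤ _ := Real.add_one_le_exp _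

variable {Ω E : Type*} [MeasurableSpace Ω] [MeasurableSpace E] {μ : Measure Ω}
  [IsProbabilityMeasure μ] {P : Measure E} [IsProbabilityMeasure P] {n : ℕ} {Z : Fin n → Ω → E}

/-- One-sided Bernstein inequality for the sum over an i.i.d. sample. -/
theorem measureReal_sum_ge_le (hZ : ∀ i, Measurable (Z i)) (hind : iIndepFun Z μ)
    (hlaw : ∀ i, μ.map (Z i) = P) {Y : E → ℝ} (hY : Measurable Y) {V τ : ℝ}
    (hb : ∀ᵐ z ∂P, |Y z| ≤ V) (h0 : ∫ z, Y z ∂P = 0) (h2 : ∫ z, Y z ^ 2 ∂P ≤ V)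
    (hV : 0 < V) (hτ0 : 0 ≤ τ) (hτ1 : τ ≤ 1) :
    μ.real {ω | n * τ ≤ ∑ i, Y (Z i ω)} ≤ Real.exp (-(n * τ ^ 2 / (4 * V))) := by
  -- The minimiser of `-a * τ + a ^ 2 * V`, with value `-τ ^ 2 / (4 * V)`. As `τ ≤ 1`, it satisfies
  -- `a * V ≤ 1`, so a single `V` can bound both the supremum and the variance.
  set a := τ / (2 * V) with ha
  have ha0 : 0 ≤ a := by positivity
  have haV : a * V ≤ 1 := by
    rw [ha]; field_simp; linarith
  have hYZ : ∀ i, Measurable fun ω => Y (Z i ω) := fun i => hY.comp (hZ i)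
  have hbi : ∀ i, ∀ᵐ ω ∂μ, |Y (Z i ω)| ≤ V := fun i => by
    have := hlaw i ▸ hb
    exact ae_of_ae_map (hZ i).aemeasurable this
  have hint : Integrable (fun ω => Real.exp (a * ∑ i, Y (Z i ω))) μ := by
    refine Integrable.of_bound (Measurable.aestronglyMeasurable
      ((Finset.measurable_sum _ fun i _ => hYZ i).const_mul a).exp) (Real.exp (a * ∑ _i : Fin n, V)) ?_
    filter_upwards [ae_all_iff.2 hbi] with ω hω
    rw [Real.norm_eq_abs, Real.abs_exp]
    gcongr with i
    exact (le_abs_self _).trans (hω i)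
  have hsum : (∑ i, fun ω => Y (Z i ω)) = fun ω => ∑ i, Y (Z i ω) := by
    ext ω; simp
  have hmgf : mgf (fun ω => ∑ i, Y (Z i ω)) μ a ≤ Real.exp (n * (a ^ 2 * V)) := by
    have hind' : iIndepFun (fun i ω => Y (Z i ω)) μ := hind.comp (fun _ => Y) fun _ => hY
    rw [← hsum, hind'.mgf_sum hYZ, Real.exp_nat_mul]
    have : ∀ i : Fin n, mgf (fun ω => Y (Z i ω)) μ a ≤ Real.exp (a ^ 2 * V) := by
      intro i
      have e : mgf (fun ω => Y (Z i ω)) μ a = mgf Y P a := by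
        rw [← hlaw i, mgf_map (hZ i).aemeasurable (by fun_prop)]
        rfl
      rw [e]
      exact mgf_le_exp_of_abs_le hY.aemeasurable hb h0 h2 ha0 haV
    simpa using Finset.prod_le_prod (s := Finset.univ) (fun i _ => mgf_nonneg) fun i _ => this i
  calc μ.real {ω | n * τ ≤ ∑ i, Y (Z i ω)}
      ≤ Real.exp (-a * (n * τ)) * mgf (fun ω => ∑ i, Y (Z i ω)) μ a :=
        measure_ge_le_exp_mul_mgf _ ha0 hint
    _ ≤ Real.exp (-a * (n * τ)) * Real.exp (n * (a ^ 2 * V)) := by gcongr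
    _ = _ := by
      rw [← Real.exp_add]
      congr 1
      rw [ha]
      field_simp
      ring

/-- Two-sided Bernstein inequality for the mean over an i.i.d. sample. -/
theorem measureReal_abs_mean_gt_le (hZ : ∀ i, Measurable (Z i)) (hind : iIndepFun Z μ)
    (hlaw : ∀ i, μ.map (Z i) = P) {Y : E → ℝ} (hY : Measurable Y) {V τ : ℝ}
    (hb : ∀ᵐ z ∂P, |Y z| ≤ V) (h0 : ∫ z, Y z ∂P = 0) (h2 : ∫ z, Y z ^ 2 ∂P ≤ V)
    (hV : 0 < V) (hτ0 : 0 ≤ τ) (hτ1 : τ ≤ 1) :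
    μ.real {ω | ¬ |(∑ i, Y (Z i ω)) / n| ≤ τ} ≤ 2 * Real.exp (-(n * τ ^ 2 / (4 * V))) := by
  have h1 := measureReal_sum_ge_le hZ hind hlaw hY hb h0 h2 hV hτ0 hτ1
  have h3 := measureReal_sum_ge_le hZ hind hlaw hY.neg (V := V) (by simpa using hb)
    (by simpa [integral_neg] using h0) (by simpa using h2) hV hτ0 hτ1
  have hsub : {ω | ¬ |(∑ i, Y (Z i ω)) / n| ≤ τ} ⊆
      {ω | n * τ ≤ ∑ i, Y (Z i ω)} ∪ {ω | n * τ ≤ ∑ i, (-Y) (Z i ω)} := by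
    intro ω hω
    rcases Nat.eq_zero_or_pos n with rfl | hn
    · simp
    have hn' : (0 : ℝ) < n := by exact_mod_cast hn
    simp only [Set.mem_ofPred_eq, abs_div, Nat.abs_cast, div_le_iff₀ hn', not_le] at hω
    simp only [Set.mem_union, Set.mem_ofPred_eq, Pi.neg_apply, Finset.sum_neg_distrib]
    rcases lt_abs.1 hω with h | h
    · left; linarith
    · right; linarith
  refine (measureReal_mono hsub).trans ((measureReal_union_le _ _).trans ?_)
  linarith

end Bernstein

/-! ### Local infima of the kernel. -/

section LocalInf

/-- The infimum of `K` over the open ball of radius `ε` around `v`. -/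
noncomputable def localInf (K : ℝ → ℝ) (ε v : ℝ) : ℝ := sInf (K '' Metric.ball v ε)

variable {K : ℝ → ℝ} {ε : ℝ}

theorem localInf_le (hK : ∀ u, 0 ≤ K u) {v w : ℝ} (hw : w ∈ Metric.ball v ε) :
    localInf K ε v ≤ K w :=
  csInf_le ⟨0, by rintro _ ⟨u, _, rfl⟩; exact hK u⟩ ⟨w, hw, rfl⟩

theorem localInf_nonneg (hK : ∀ u, 0 ≤ K u) (v : ℝ) : 0 ≤ localInf K ε v :=
  Real.sInf_nonneg (by rintro _ ⟨u, _, rfl⟩; exact hK u)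

theorem le_localInf (hε : 0 < ε) {v a : ℝ} (h : ∀ w ∈ Metric.ball v ε, a ≤ K w) :
    a ≤ localInf K ε v :=
  le_csInf ⟨_, v, Metric.mem_ball_self hε, rfl⟩ (by rintro _ ⟨u, hu, rfl⟩; exact h u hu)

/-- An infimum over open balls is upper semicontinuous: it is below `a` at `v` exactly when `v` lies
within `ε` of some point where `K < a`, so strict sublevel sets are unions of balls. -/
theorem measurable_localInf (hK : ∀ u, 0 ≤ K u) (hε : 0 < ε) : Measurable (localInf K ε) := by
  refine measurable_of_Iio fun a => IsOpen.measurableSet ?_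
  have : localInf K ε ⁻¹' Set.Iio a = ⋃ w ∈ {w | K w < a}, Metric.ball w ε := by
    ext v
    simp only [Set.mem_preimage, Set.mem_Iio, Set.mem_ofPred_eq, Set.mem_iUnion, exists_prop]
    constructor
    · intro h
      by_contra! hcon
      refine absurd (le_localInf hε fun w hw => ?_) (not_le.2 h)
      by_contra! hlt
      exact hcon w hlt (Metric.mem_ball_comm.1 hw)
    · rintro ⟨w, hw, hv⟩
      exact (localInf_le hK (Metric.mem_ball_comm.1 hv)).trans_lt hw
  rw [this]
  exact isOpen_biUnion fun w _ => Metric.isOpen_ball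

/-- Local infima of an almost everywhere continuous density keep at least half of its mass when
the radius is small. -/
theorem exists_half_le_integral_localInf (hK : IsSymmKernel K) :
    ∃ ε > 0, 1 / 2 ≤ ∫ v, localInf K ε v := by
  have hε : ∀ k : ℕ, (0 : ℝ) < 1 / ((k : ℝ) + 1) := fun k => Nat.one_div_pos_of_nat
  have hlim : Tendsto (fun k : ℕ => ∫ v, localInf K (1 / ((k : ℝ) + 1)) v) atTop
      (𝓝 (∫ v, K v)) := by
    -- As the radius shrinks, the local infimum tends to `K` at every continuity point of `K`, and
    -- `K` itself dominates.
    refine tendsto_integral_of_dominated_convergence K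
      (fun k => (measurable_localInf hK.nonneg (hε k)).aestronglyMeasurable) hK.integrable
      (fun k => ae_of_all _ fun v => ?_) ?_
    · rw [Real.norm_of_nonneg (localInf_nonneg hK.nonneg v)]
      exact localInf_le hK.nonneg (Metric.mem_ball_self (hε k))
    · filter_upwards [hK.ae_continuousAt] with v hv
      rw [Metric.tendsto_atTop]
      intro η hη
      obtain ⟨d, hd, hball⟩ := Metric.continuousAt_iff.1 hv (η / 2) (half_pos hη)
      obtain ⟨k₀, hk₀⟩ := exists_nat_one_div_lt hd
      refine ⟨k₀, fun k hk => ?_⟩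
      have h1 : localInf K (1 / ((k : ℝ) + 1)) v ≤ K v :=
        localInf_le hK.nonneg (Metric.mem_ball_self (hε k))
      have h2 : K v - η / 2 ≤ localInf K (1 / ((k : ℝ) + 1)) v := by
        refine le_localInf (hε k) fun w hw => ?_
        have h3 : dist w v < d := (Metric.mem_ball.1 hw).trans
          ((Nat.one_div_le_one_div hk).trans_lt hk₀)
        have h4 := hball h3
        rw [Real.dist_eq] at h4
        linarith [(abs_lt.1 h4).1]
      rw [Real.dist_eq, abs_lt]
      constructor <;> linarith
  rw [hK.integral_eq_one] at hlim
  obtain ⟨k, hk⟩ := (hlim.eventually (lt_mem_nhds (show (1 / 2 : ℝ) < 1 by norm_num))).exists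
  exact ⟨_, hε k, hk.le⟩

end LocalInf

/-! ### Conditional means of the weights. -/

section Smoothing

variable {𝒳 : Type*} [MeasurableSpace 𝒳]

/-- The conditional expectation of `W(T)` given `X = x`, for the conditional density `f`. -/
noncomputable def condMean (f : ℝ → 𝒳 → ℝ) (W : ℝ → ℝ) (x : 𝒳) : ℝ := ∫ τ, W τ * f τ x

theorem measurable_condMean {f : ℝ → 𝒳 → ℝ} (hf : Measurable fun z : 𝒳 × ℝ => f z.2 z.1)
    {W : ℝ → ℝ} (hW : Measurable W) : Measurable (condMean f W) := by
  have : StronglyMeasurable (fun z : 𝒳 × ℝ => W z.2 * f z.2 z.1) :=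
    ((hW.comp measurable_snd).mul hf).stronglyMeasurable
  exact (this.integral_prod_right (ν := volume)).measurable

theorem integral_mul_eq_integral_mul_condMean {P : Measure (𝒳 × ℝ)} [IsProbabilityMeasure P]
    {f : ℝ → 𝒳 → ℝ} (hf : IsCondDensity P f) {ψ : 𝒳 → ℝ} {W : ℝ → ℝ}
    (hi : Integrable (fun z : 𝒳 × ℝ => ψ z.1 * W z.2) P) :
    ∫ z, ψ z.1 * W z.2 ∂P = ∫ x, ψ x * condMean f W x ∂P.fst := by
  have hm : Measurable fun z : 𝒳 × ℝ => ENNReal.ofReal (f z.2 z.1) := hf.measurable.ennreal_ofReal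
  have hlt : ∀ᵐ z ∂P.fst.prod volume, ENNReal.ofReal (f z.2 z.1) < ⊤ := by simp
  have hi' := hi
  rw [hf.law, integrable_withDensity_iff_integrable_smul' hm hlt] at hi'
  have h1 : ∫ z, ψ z.1 * W z.2 ∂P =
      ∫ z, ψ z.1 * W z.2 ∂((P.fst.prod volume).withDensity
        fun z => ENNReal.ofReal (f z.2 z.1)) := by
    conv_lhs => rw [hf.law]
  rw [h1, integral_withDensity_eq_integral_toReal_smul hm hlt, integral_prod _ hi']
  refine integral_congr_ae (ae_of_all _ fun x => ?_)
  simp only [condMean]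
  rw [← integral_const_mul]
  refine integral_congr_ae (ae_of_all _ fun τ => ?_)
  simp only [smul_eq_mul]
  rw [ENNReal.toReal_ofReal (hf.nonneg _ _)]
  ring

/-- Overlap on the support of the weight bounds the conditional mean of the weight. -/
theorem condMean_mem_Icc {Q : Measure 𝒳} [IsProbabilityMeasure Q] {f : ℝ → 𝒳 → ℝ}
    (hf : Measurable fun z : 𝒳 × ℝ => f z.2 z.1) {A : Set ℝ} (hA : MeasurableSet A) {C : ℝ}
    (hov : ∀ t ∈ A, ∀ᵐ x ∂Q, C ≤ f t x ∧ f t x ≤ 1 / C) {W : ℝ → ℝ} (hW0 : ∀ τ, 0 ≤ W τ)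
    (hWi : Integrable W) (hWA : ∀ τ ∉ A, W τ = 0) :
    ∀ᵐ x ∂Q, C * ∫ τ, W τ ≤ condMean f W x ∧ condMean f W x ≤ 1 / C * ∫ τ, W τ := by
  have hms : MeasurableSet {z : 𝒳 × ℝ | z.2 ∈ A → C ≤ f z.2 z.1 ∧ f z.2 z.1 ≤ 1 / C} :=
    (measurable_snd hA).himp
      ((measurableSet_le measurable_const hf).inter (measurableSet_le hf measurable_const))
  -- The exceptional null set in the overlap condition depends on `t`. Fubini exchanges the
  -- quantifiers: for almost every `x` the bounds hold at almost every `τ`, enough under the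
  -- integral.
  have hae : ∀ᵐ x ∂Q, ∀ᵐ τ : ℝ, τ ∈ A → C ≤ f τ x ∧ f τ x ≤ 1 / C := by
    refine (Measure.ae_ae_comm (p := fun x τ => τ ∈ A → C ≤ f τ x ∧ f τ x ≤ 1 / C) hms).2 ?_
    refine ae_of_all _ fun τ => ?_
    by_cases hτ : τ ∈ A
    · filter_upwards [hov τ hτ] with x hx _ using hx
    · exact ae_of_all _ fun x h => absurd h hτ
  filter_upwards [hae] with x hx
  have hlow : ∀ᵐ τ : ℝ, C * W τ ≤ W τ * f τ x := by
    filter_upwards [hx] with τ hτ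
    by_cases h : τ ∈ A
    · rw [mul_comm]; exact mul_le_mul_of_nonneg_left (hτ h).1 (hW0 τ)
    · simp [hWA τ h]
  have hup : ∀ᵐ τ : ℝ, W τ * f τ x ≤ 1 / C * W τ := by
    filter_upwards [hx] with τ hτ
    by_cases h : τ ∈ A
    · rw [mul_comm (1 / C)]; exact mul_le_mul_of_nonneg_left (hτ h).2 (hW0 τ)
    · simp [hWA τ h]
  have hfx : Measurable fun τ => f τ x := hf.comp measurable_prodMk_left
  have hint : Integrable fun τ => W τ * f τ x := by
    refine ((hWi.const_mul |C|).add (hWi.const_mul |1 / C|)).mono'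
      (hWi.aestronglyMeasurable.mul hfx.aestronglyMeasurable) ?_
    filter_upwards [hlow, hup] with τ h1 h2
    have h3 := mul_le_mul_of_nonneg_right (neg_abs_le C) (hW0 τ)
    have h4 := mul_le_mul_of_nonneg_right (le_abs_self (1 / C)) (hW0 τ)
    have h5 : 0 ≤ |C| * W τ := mul_nonneg (abs_nonneg _) (hW0 τ)
    have h6 : 0 ≤ |1 / C| * W τ := mul_nonneg (abs_nonneg _) (hW0 τ)
    rw [Real.norm_eq_abs, abs_le]
    simp only [Pi.add_apply]
    constructor <;> linarith
  rw [← integral_const_mul, ← integral_const_mul]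
  exact ⟨integral_mono_ae (hWi.const_mul C) hint hlow,
    integral_mono_ae hint (hWi.const_mul _) hup⟩

end Smoothing

/-! ### Fluctuation of the Gram entries. -/

section Deviation

theorem integrable_of_measurable_of_abs_le {E : Type*} [MeasurableSpace E] {P : Measure E}
    [IsFiniteMeasure P] {φ : E → ℝ} (hφ : Measurable φ) {a : ℝ} (h : ∀ᵐ z ∂P, |φ z| ≤ a) :
    Integrable φ P :=
  Integrable.of_bound hφ.aestronglyMeasurable a h

variable {𝒳 : Type*} [MeasurableSpace 𝒳]

theorem ae_fst {P : Measure (𝒳 × ℝ)} {q : 𝒳 → Prop} (h : ∀ᵐ x ∂P.fst, q x) :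
    ∀ᵐ z ∂P, q z.1 :=
  ae_of_ae_map measurable_fst.aemeasurable h

theorem BasisBounds.sq_integrable {p : ℕ} {Q : Measure 𝒳} [IsProbabilityMeasure Q]
    {b : Fin p → 𝒳 → ℝ} {ζ C : ℝ} (hb : BasisBounds Q b ζ C) (j : Fin p) :
    Integrable (fun x => b j x ^ 2) Q := by
  refine integrable_of_measurable_of_abs_le ((hb.measurable j).pow_const 2) (a := ζ ^ 2) ?_
  filter_upwards [hb.sup_le] with x hx
  rw [abs_pow]
  exact pow_le_pow_left₀ (abs_nonneg _) (hx j) 2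

/-- A lower bound for `ζ ^ 2` lets the rate condition force `n * h` to stay away from zero. -/
theorem BasisBounds.le_sq {p : ℕ} {Q : Measure 𝒳} [IsProbabilityMeasure Q]
    {b : Fin p → 𝒳 → ℝ} {ζ C : ℝ} (hb : BasisBounds Q b ζ C) (j : Fin p) : C ≤ ζ ^ 2 := by
  refine (hb.le_moment j).trans ?_
  calc ∫ x, b j x ^ 2 ∂Q ≤ ∫ _x, ζ ^ 2 ∂Q := by
        refine integral_mono_ae (hb.sq_integrable j) (integrable_const _) ?_
        filter_upwards [hb.sup_le] with x hx
        rw [← sq_abs]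
        exact pow_le_pow_left₀ (abs_nonneg _) (hx j) 2
    _ = ζ ^ 2 := by simp

/-- Deviation of an entry of the weighted empirical Gram matrix from its conditional mean. -/
theorem measureReal_gram_deviation_le {Ω : Type*} [MeasurableSpace Ω] {μ : Measure Ω}
    [IsProbabilityMeasure μ] {P : Measure (𝒳 × ℝ)} [IsProbabilityMeasure P] {n p : ℕ}
    {X : Fin n → Ω → 𝒳} {T : Fin n → Ω → ℝ} (hiid : IsIIDSample μ P X T)
    {f : ℝ → 𝒳 → ℝ} (hf : IsCondDensity P f) {b : Fin p → 𝒳 → ℝ} {ζ C : ℝ}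
    (hC0 : 0 < C) (hC1 : C < 1) (hb : BasisBounds P.fst b ζ C) {W : ℝ → ℝ} (hW : Measurable W)
    (hW0 : ∀ τ, 0 ≤ W τ) {B : ℝ} (hWB : ∀ τ, W τ ≤ B)
    (hg : ∀ᵐ x ∂P.fst, 0 ≤ condMean f W x ∧ condMean f W x ≤ 1 / C)
    {V τ : ℝ} (hV0 : 0 < V) (hV : ζ ^ 2 * (B + 1 / C) / C ^ 2 ≤ V) (hτ0 : 0 ≤ τ) (hτ1 : τ ≤ 1)
    (j l : Fin p) :
    μ.real {ω | ¬ |(∑ i, b j (X i ω) * b l (X i ω) *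
      (W (T i ω) - condMean f W (X i ω))) / n| ≤ τ} ≤ 2 * Real.exp (-(n * τ ^ 2 / (4 * V))) := by
  have : IsProbabilityMeasure P.fst := inferInstance
  set g := condMean f W with hgdef
  have hgm : Measurable g := measurable_condMean hf.measurable hW
  have hB0 : 0 ≤ B := (hW0 0).trans (hWB 0)
  have hbj := hb.measurable j
  have hbl := hb.measurable l
  have hψ : ∀ᵐ x ∂P.fst, |b j x * b l x| ≤ ζ ^ 2 := by
    filter_upwards [hb.sup_le] with x hx
    rw [abs_mul, sq]
    exact mul_le_mul (hx j) (hx l) (abs_nonneg _) ((abs_nonneg _).trans (hx j))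
  have hφ : ∀ᵐ x ∂P.fst, (b j x * b l x) ^ 2 ≤ ζ ^ 2 * b j x ^ 2 := by
    filter_upwards [hb.sup_le] with x hx
    rw [mul_pow, mul_comm]
    refine mul_le_mul_of_nonneg_right ?_ (sq_nonneg _)
    rw [← sq_abs]
    exact pow_le_pow_left₀ (abs_nonneg _) (hx l) 2
  -- Used twice: with `b j * b l` to see that `Y` is centred, and with its square for the variance.
  have hmean : ∀ (ψ : 𝒳 → ℝ) (a : ℝ), Measurable ψ → (∀ᵐ x ∂P.fst, |ψ x| ≤ a) →
      Integrable (fun z : 𝒳 × ℝ => ψ z.1 * W z.2) P ∧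
      Integrable (fun z : 𝒳 × ℝ => ψ z.1 * g z.1) P ∧ Integrable (fun x => ψ x * g x) P.fst ∧
      ∫ z, ψ z.1 * W z.2 ∂P = ∫ x, ψ x * g x ∂P.fst ∧
      ∫ z, ψ z.1 * g z.1 ∂P = ∫ x, ψ x * g x ∂P.fst := by
    intro ψ a hψm hψa
    have i1 : Integrable (fun z : 𝒳 × ℝ => ψ z.1 * W z.2) P := by
      refine integrable_of_measurable_of_abs_le (by fun_prop) (a := a * B) ?_
      filter_upwards [ae_fst hψa] with z hz
      rw [abs_mul, abs_of_nonneg (hW0 _)]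
      exact mul_le_mul hz (hWB _) (hW0 _) ((abs_nonneg _).trans hz)
    have i3 : Integrable (fun x => ψ x * g x) P.fst := by
      refine integrable_of_measurable_of_abs_le (by fun_prop) (a := a * (1 / C)) ?_
      filter_upwards [hψa, hg] with x hx hgx
      rw [abs_mul, abs_of_nonneg hgx.1]
      exact mul_le_mul hx hgx.2 hgx.1 ((abs_nonneg _).trans hx)
    refine ⟨i1, i3.comp_measurable measurable_fst, i3,
      integral_mul_eq_integral_mul_condMean hf i1, ?_⟩
    rw [Measure.fst, integral_map measurable_fst.aemeasurable (by fun_prop)]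
  set Y : 𝒳 × ℝ → ℝ := fun z => b j z.1 * b l z.1 * (W z.2 - g z.1) with hYdef
  have hYm : Measurable Y := by fun_prop
  have hC2 : C ^ 2 ≤ 1 := pow_le_one₀ hC0.le hC1.le
  have hVb : ζ ^ 2 * (B + 1 / C) ≤ V := by
    refine le_trans ?_ hV
    exact le_div_self (by positivity) (by positivity) hC2
  have hYb : ∀ᵐ z ∂P, |Y z| ≤ V := by
    filter_upwards [ae_fst hψ, ae_fst hg] with z h1 h2
    refine le_trans ?_ hVb
    rw [hYdef, abs_mul]
    refine mul_le_mul h1 ?_ (abs_nonneg _) (sq_nonneg _)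
    rw [abs_le]
    have := hW0 z.2
    have := hWB z.2
    have : 0 ≤ 1 / C := by positivity
    constructor <;> linarith [h2.1, h2.2]
  have hY0 : ∫ z, Y z ∂P = 0 := by
    obtain ⟨i1, i2, _, e1, e2⟩ := hmean (fun x => b j x * b l x) (ζ ^ 2) (by fun_prop) hψ
    simp_rw [hYdef, mul_sub]
    rw [integral_sub i1 i2, e1, e2, sub_self]
  have hY2 : ∫ z, Y z ^ 2 ∂P ≤ V := by
    refine le_trans ?_ hV
    have hφb : ∀ᵐ x ∂P.fst, |(b j x * b l x) ^ 2| ≤ (ζ ^ 2) ^ 2 := by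
      filter_upwards [hψ] with x hx
      rw [abs_pow]
      exact pow_le_pow_left₀ (abs_nonneg _) hx 2
    obtain ⟨i1, i2, i3, e1, e2⟩ :=
      hmean (fun x => (b j x * b l x) ^ 2) ((ζ ^ 2) ^ 2) (by fun_prop) hφb
    calc ∫ z, Y z ^ 2 ∂P
        ≤ ∫ z, (B * ((b j z.1 * b l z.1) ^ 2 * W z.2) +
            1 / C * ((b j z.1 * b l z.1) ^ 2 * g z.1)) ∂P := by
          refine integral_mono_of_nonneg (ae_of_all _ fun z => sq_nonneg _)
            ((i1.const_mul B).add (i2.const_mul (1 / C))) ?_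
          filter_upwards [ae_fst hg] with z hz
          -- Being linear in `W`, this bound integrates to a multiple of `g`, so the variance grows
          -- like `B` and not `B ^ 2`. With `B` of order `1 / h`, this yields the effective sample
          -- size `n * h`.
          have h1 : (W z.2 - g z.1) ^ 2 ≤ B * W z.2 + 1 / C * g z.1 := by
            nlinarith [mul_nonneg (hW0 z.2) hz.1,
              mul_nonneg (hW0 z.2) (sub_nonneg.2 (hWB z.2)),
              mul_nonneg hz.1 (sub_nonneg.2 hz.2)]
          calc Y z ^ 2 = (b j z.1 * b l z.1) ^ 2 * (W z.2 - g z.1) ^ 2 := by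
                rw [hYdef, mul_pow]
            _ ≤ (b j z.1 * b l z.1) ^ 2 * (B * W z.2 + 1 / C * g z.1) := by gcongr
            _ = _ := by ring
      _ = (B + 1 / C) * ∫ x, (b j x * b l x) ^ 2 * g x ∂P.fst := by
          rw [integral_add (i1.const_mul B) (i2.const_mul (1 / C)), integral_const_mul,
            integral_const_mul, e1, e2]
          ring
      _ ≤ (B + 1 / C) * (ζ ^ 2 * (1 / C) * (1 / C)) := by
          gcongr
          calc ∫ x, (b j x * b l x) ^ 2 * g x ∂P.fst
              ≤ ∫ x, ζ ^ 2 * (1 / C) * b j x ^ 2 ∂P.fst := by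
                refine integral_mono_ae i3 ((hb.sq_integrable j).const_mul _) ?_
                filter_upwards [hφ, hg] with x h1 h2
                calc (b j x * b l x) ^ 2 * g x ≤ ζ ^ 2 * b j x ^ 2 * (1 / C) :=
                      mul_le_mul h1 h2.2 h2.1 (by positivity)
                  _ = _ := by ring
            _ = ζ ^ 2 * (1 / C) * ∫ x, b j x ^ 2 ∂P.fst := integral_const_mul _ _
            _ ≤ _ := by
                gcongr
                exact hb.moment_le j
      _ = ζ ^ 2 * (B + 1 / C) / C ^ 2 := by
          field_simp
  exact measureReal_abs_mean_gt_le (Z := fun i ω => (X i ω, T i ω))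
    (fun i => (hiid.measurable_X i).prodMk (hiid.measurable_T i)) hiid.indep hiid.law hYm hYb hY0
    hY2 hV0 hτ0 hτ1

end Deviation

/-! ### Lower weights at grid points. -/

section Grid

/-- The lower kernel weight centred at the grid point `a`. -/
noncomputable def lowerWeight (K : ℝ → ℝ) (ε h a τ : ℝ) : ℝ := localInf K ε ((τ - a) / h) / h

variable {K : ℝ → ℝ} {ε h : ℝ}

theorem integrable_localInf (hK : IsSymmKernel K) (hε : 0 < ε) : Integrable (localInf K ε) :=
  hK.integrable.mono' (measurable_localInf hK.nonneg hε).aestronglyMeasurable <|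
    ae_of_all _ fun v => by
      rw [Real.norm_of_nonneg (localInf_nonneg hK.nonneg v)]
      exact localInf_le hK.nonneg (Metric.mem_ball_self hε)

theorem measurable_lowerWeight (hK : IsSymmKernel K) (hε : 0 < ε) (a : ℝ) :
    Measurable (lowerWeight K ε h a) := by
  have := measurable_localInf hK.nonneg hε
  unfold lowerWeight
  fun_prop

theorem lowerWeight_nonneg (hK : IsSymmKernel K) (hh : 0 < h) (a τ : ℝ) :
    0 ≤ lowerWeight K ε h a τ :=
  div_nonneg (localInf_nonneg hK.nonneg _) hh.le

/-- Moving the centre from `a` to `t` shifts the argument of `K` by less than `ε`, which the infimum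
over the ball absorbs. -/
theorem lowerWeight_le (hK : IsSymmKernel K) (hh : 0 < h) {a t : ℝ}
    (hat : |t - a| < ε * h) (τ : ℝ) : lowerWeight K ε h a τ ≤ K ((τ - t) / h) / h := by
  refine div_le_div_of_nonneg_right (localInf_le hK.nonneg ?_) hh.le
  rw [Metric.mem_ball, Real.dist_eq, ← sub_div, abs_div, abs_of_pos hh, div_lt_iff₀ hh]
  rwa [show τ - t - (τ - a) = -(t - a) by ring, abs_neg]

theorem integrable_lowerWeight (hK : IsSymmKernel K) (hε : 0 < ε) (hh : 0 < h) (a : ℝ) :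
    Integrable (lowerWeight K ε h a) :=
  (((integrable_localInf hK hε).comp_div hh.ne').comp_sub_right a).div_const h

theorem integral_lowerWeight (hh : 0 < h) (a : ℝ) :
    ∫ τ, lowerWeight K ε h a τ = ∫ v, localInf K ε v := by
  unfold lowerWeight
  rw [integral_div, integral_sub_right_eq_self (fun τ => localInf K ε (τ / h)) a,
    Measure.integral_comp_div, abs_of_pos hh, smul_eq_mul]
  field_simp

/-- The conditional mean of the lower weight lies between `C / 2` and `1 / C`, when the support
of the weight is inside the overlap region. -/
theorem condMean_lowerWeight_mem_Icc {𝒳 : Type*} [MeasurableSpace 𝒳] (hK : IsSymmKernel K)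
    (hε : 0 < ε) (hhalf : 1 / 2 ≤ ∫ v, localInf K ε v) (hh : 0 < h) {R₀ r : ℝ}
    (hsupp : ∀ v, K v ≠ 0 → |v| ≤ R₀) (hhr : (R₀ + ε) * h ≤ r) {𝒯 𝒯' : Set ℝ}
    (h𝒯' : MeasurableSet 𝒯') (hthick : Metric.cthickening r 𝒯 ⊆ 𝒯') {Q : Measure 𝒳}
    [IsProbabilityMeasure Q] {f : ℝ → 𝒳 → ℝ} (hf : Measurable fun z : 𝒳 × ℝ => f z.2 z.1) {C : ℝ}
    (hC0 : 0 < C) (hov : ∀ t ∈ 𝒯', ∀ᵐ x ∂Q, C ≤ f t x ∧ f t x ≤ 1 / C) {a t : ℝ} (ht : t ∈ 𝒯)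
    (hat : |t - a| < ε * h) :
    ∀ᵐ x ∂Q, C / 2 ≤ condMean f (lowerWeight K ε h a) x ∧
      condMean f (lowerWeight K ε h a) x ≤ 1 / C := by
  -- A nonzero weight forces `|τ - a| ≤ R₀ * h`, and `a` is within `ε * h` of `t ∈ 𝒯`, so `τ` lies
  -- in the `r`-thickening of `𝒯`.
  have hoff : ∀ τ ∉ 𝒯', lowerWeight K ε h a τ = 0 := by
    intro τ hτ
    by_contra hne
    have h1 : K ((τ - a) / h) ≠ 0 := by
      intro h0
      refine hne (le_antisymm ?_ (lowerWeight_nonneg hK hh a τ))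
      have := lowerWeight_le (ε := ε) hK hh (a := a) (t := a)
        (by simpa using mul_pos hε hh) τ
      simpa [h0] using this
    have h2 := hsupp _ h1
    rw [abs_div, abs_of_pos hh, div_le_iff₀ hh] at h2
    refine hτ (hthick (Metric.mem_cthickening_of_dist_le τ t r 𝒯 ht ?_))
    rw [Real.dist_eq]
    calc |τ - t| ≤ |τ - a| + |a - t| := abs_sub_le _ _ _
      _ ≤ R₀ * h + ε * h := by rw [abs_sub_comm a t]; gcongr
      _ ≤ r := by linarith
  have hle1 : ∫ v, localInf K ε v ≤ 1 := by
    rw [← hK.integral_eq_one]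
    exact integral_mono (integrable_localInf hK hε) hK.integrable
      fun v => localInf_le hK.nonneg (Metric.mem_ball_self hε)
  filter_upwards [condMean_mem_Icc hf h𝒯' hov (lowerWeight_nonneg hK hh a)
    (integrable_lowerWeight hK hε hh a) hoff] with x hx
  rw [integral_lowerWeight hh] at hx
  constructor
  · refine le_trans ?_ hx.1
    rw [div_eq_mul_one_div]
    gcongr
  · refine hx.2.trans ?_
    exact mul_le_of_le_one_right (by positivity) hle1

end Grid

/-! ### The grid and the union bound. -/

section Union

open Classical in
/-- The indices of the points of the grid of mesh `d` near `𝒯`, where `𝒯 ⊆ [-R, R]`. -/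
noncomputable def gridIndices (𝒯 : Set ℝ) (R d : ℝ) : Finset ℤ :=
  (Finset.Icc (-(⌈R / d⌉ + 1)) (⌈R / d⌉ + 1)).filter fun k => ∃ t ∈ 𝒯, |t - k * d| < d

theorem mem_gridIndices {𝒯 : Set ℝ} {R d : ℝ} {k : ℤ} : k ∈ gridIndices 𝒯 R d ↔
    k ∈ Finset.Icc (-(⌈R / d⌉ + 1)) (⌈R / d⌉ + 1) ∧ ∃ t ∈ 𝒯, |t - k * d| < d := by
  classical
  simp [gridIndices]

theorem exists_mem_gridIndices {𝒯 : Set ℝ} {R d : ℝ} (hd : 0 < d) (hR : ∀ t ∈ 𝒯, |t| ≤ R)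
    {t : ℝ} (ht : t ∈ 𝒯) : ∃ k ∈ gridIndices 𝒯 R d, |t - k * d| < d := by
  have h1 : (⌊t / d⌋ : ℝ) * d ≤ t := by
    rw [← le_div_iff₀ hd]; exact Int.floor_le _
  have h2 : t < (⌊t / d⌋ + 1) * d := by
    rw [← div_lt_iff₀ hd]; exact Int.lt_floor_add_one _
  have h3 : |t - ⌊t / d⌋ * d| < d := by
    rw [abs_lt]; constructor <;> linarith
  have h4 := abs_le.1 (hR t ht)
  have h5 : t / d ≤ R / d := by gcongr; exact h4.2
  have h6 : -(R / d) ≤ t / d := by rw [← neg_div]; gcongr; exact h4.1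
  have h7 := Int.le_ceil (R / d)
  refine ⟨⌊t / d⌋, ?_, h3⟩
  rw [mem_gridIndices, Finset.mem_Icc]
  refine ⟨⟨?_, ?_⟩, t, ht, h3⟩
  · rw [Int.le_floor]; push_cast; linarith
  · have : (⌊t / d⌋ : ℝ) ≤ ⌈R / d⌉ := (Int.floor_le _).trans (h5.trans h7)
    have : ⌊t / d⌋ ≤ ⌈R / d⌉ := by exact_mod_cast this
    omega

theorem card_gridIndices_le {𝒯 : Set ℝ} {R d : ℝ} (hR : 0 ≤ R) (hd : 0 < d) :
    ((gridIndices 𝒯 R d).card : ℝ) ≤ 2 * (R / d) + 5 := by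
  have h1 : 0 ≤ ⌈R / d⌉ := Int.ceil_nonneg (by positivity)
  have h2 : ((gridIndices 𝒯 R d).card : ℤ) ≤ 2 * ⌈R / d⌉ + 3 := by
    have hsub : gridIndices 𝒯 R d ⊆ Finset.Icc (-(⌈R / d⌉ + 1)) (⌈R / d⌉ + 1) :=
      fun k hk => (mem_gridIndices.1 hk).1
    have := Finset.card_le_card hsub
    rw [Int.card_Icc] at this
    omega
  have h3 : ((gridIndices 𝒯 R d).card : ℝ) ≤ 2 * ⌈R / d⌉ + 3 := by exact_mod_cast h2
  linarith [(Int.ceil_lt_add_one (R / d))]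

theorem measureReal_iUnion_three_le {Ω ι : Type*} [MeasurableSpace Ω] {μ : Measure Ω}
    [IsFiniteMeasure μ] (G : Finset ι) {p : ℕ} (A : ι → Fin p → Fin p → Set Ω) {a : ℝ}
    (hA : ∀ k ∈ G, ∀ j l, μ.real (A k j l) ≤ a) :
    μ.real (⋃ k ∈ G, ⋃ j, ⋃ l, A k j l) ≤ G.card * (p * (p * a)) := by
  refine (measureReal_biUnion_finset_le _ _).trans ?_
  rw [← nsmul_eq_mul]
  refine Finset.sum_le_card_nsmul _ _ _ fun k hk => ?_
  refine (measureReal_iUnion_fintype_le _).trans ?_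
  have h1 : ∀ j ∈ (Finset.univ : Finset (Fin p)), μ.real (⋃ l, A k j l) ≤ p * a := by
    intro j _
    refine (measureReal_iUnion_fintype_le _).trans ?_
    simpa using Finset.sum_le_card_nsmul Finset.univ _ _ fun l _ => hA k hk j l
  simpa using Finset.sum_le_card_nsmul Finset.univ _ _ h1

/-- The tail bound beats the number of entries and of grid points. -/
theorem card_mul_tail_le {n p s N : ℕ} {h ζ A A₀ η V : ℝ} (hn : 0 < n)
    (hA : 0 < A) (hη : 0 < η) (hA₀ : 0 ≤ A₀) (hs : 0 < s)
    (hh : 0 < h) (hζ : 0 < ζ ^ 2) (hV : V = A * ζ ^ 2 / h)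
    (hrate : ζ ^ 2 * s ^ 2 * Real.log (max p n) ≤ η ^ 2 / (16 * A) * (n * h))
    (hN : (N : ℝ) ≤ A₀ * n) :
    N * (p * (p * (2 * Real.exp (-(n * (η / s) ^ 2 / (4 * V)))))) ≤ 2 * A₀ / n := by
  set m : ℝ := max (p : ℝ) n with hm
  have hnm : (n : ℝ) ≤ m := le_max_right _ _
  have hpm : (p : ℝ) ≤ m := le_max_left _ _
  have hn0 : (0 : ℝ) < n := by exact_mod_cast hn
  have hm0 : 0 < m := hn0.trans_le hnm
  have hs0 : (0 : ℝ) < s := by exact_mod_cast hs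
  -- The tail is then at most `m⁻⁴`: two powers of `m` cover the entries, one the grid points, and
  -- one is left over.
  have hexp : 4 * Real.log m ≤ n * (η / s) ^ 2 / (4 * V) := by
    have e : n * (η / s) ^ 2 / (4 * V) =
        4 * (η ^ 2 / (16 * A) * (n * h)) / (ζ ^ 2 * s ^ 2) := by
      have : ζ ≠ 0 := by rintro rfl; simp at hζ
      rw [hV]; field_simp; ring
    rw [e, le_div_iff₀ (by positivity)]
    linarith
  have htail : Real.exp (-(n * (η / s) ^ 2 / (4 * V))) ≤ (m ^ 4)⁻¹ := by
    rw [Real.exp_neg]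
    refine inv_anti₀ (by positivity) ?_
    calc m ^ 4 = Real.exp (4 * Real.log m) := by
          rw [show (4 : ℝ) = ((4 : ℕ) : ℝ) by norm_num, Real.exp_nat_mul, Real.exp_log hm0]
      _ ≤ _ := Real.exp_le_exp.2 hexp
  calc N * (p * (p * (2 * Real.exp (-(n * (η / s) ^ 2 / (4 * V))))))
      ≤ (A₀ * m) * (m * (m * (2 * (m ^ 4)⁻¹))) := by
        have : (N : ℝ) ≤ A₀ * m := hN.trans (by gcongr)
        gcongr
    _ = 2 * A₀ / m := by field_simp
    _ ≤ 2 * A₀ / n := by gcongr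

end Union

/-! ### Assembly: fixed `n`, then the limit. -/

/-- For a fixed sample size: outside of an event of probability at most a multiple of `1 / n`,
the sparse eigenvalue bounds imply the local compatibility condition. -/
theorem measure_local_compatibility_compl_le {Ω 𝒳 : Type*} [MeasurableSpace Ω]
    [MeasurableSpace 𝒳] {μ : Measure Ω} [IsProbabilityMeasure μ] {P : Measure (𝒳 × ℝ)}
    [IsProbabilityMeasure P] {n p s L : ℕ} {X : Fin n → Ω → 𝒳} {T : Fin n → Ω → ℝ}
    (hiid : IsIIDSample μ P X T) {K : ℝ → ℝ} (hK : IsSymmKernel K) {B ε R₀ r R : ℝ}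
    (hB0 : 0 < B) (hB : ∀ u, K u ≤ B) (hε : 0 < ε) (hhalf : 1 / 2 ≤ ∫ v, localInf K ε v)
    (hsupp : ∀ v, K v ≠ 0 → |v| ≤ R₀) {𝒯 𝒯' 𝒰 : Set ℝ} (h𝒯' : MeasurableSet 𝒯')
    (hthick : Metric.cthickening r 𝒯 ⊆ 𝒯') (hR0 : 0 ≤ R) (hR : ∀ t ∈ 𝒯, |t| ≤ R)
    {C : ℝ} (hC0 : 0 < C) (hC1 : C < 1) {f : ℝ → 𝒳 → ℝ} (hf : IsCondDensity P f)
    (hov : ∀ t ∈ 𝒯', ∀ᵐ x ∂P.fst, C ≤ f t x ∧ f t x ≤ 1 / C)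
    {b : Fin p → 𝒳 → ℝ} {ζ : ℝ} (hb : BasisBounds P.fst b ζ C) {κ₁ κ₂ q c η h : ℝ}
    (hκ₁ : 0 < κ₁) {S : ℝ → ℝ → Finset (Fin p)}
    (hS : ∀ t ∈ 𝒯, ∀ u ∈ 𝒰, (S t u).card ≤ s)
    (hL : 0 < L) (hLq : (L + 1 : ℝ) ≤ q) (hL' : max κ₂ 0 * |c| ≤ κ₁ / 2 * √L)
    (hη0 : 0 < η) (hη1 : η ≤ 1) (hη : η * (1 + |c|) ^ 2 ≤ κ₁ ^ 2 * C / 16)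
    (hh : 0 < h) (hh1 : h ≤ 1) (hhr : (R₀ + ε) * h ≤ r) (hn : 0 < n)
    (hnh : 0 < s → 0 < p → 1 ≤ n * h)
    (hrate : ζ ^ 2 * s ^ 2 * Real.log (max p n) ≤
      η ^ 2 / (16 * ((B + 1 / C) / C ^ 2)) * (n * h)) :
    μ {ω | ∀ t ∈ 𝒯, ∀ u ∈ 𝒰, ∀ δ ∈ cone c (S t u), restrictTo (S t u) δ ≠ 0 →
        κ₁ * √C / 4 ≤ empNorm (fun i => linForm b δ (X i ω) * √(K ((T i ω - t) / h))) /
          (l2Norm (restrictTo (S t u) δ) * √h)}ᶜ ≤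
    μ {ω | ∀ δ : Fin p → ℝ, δ ≠ 0 → (hammingNorm δ : ℝ) ≤ s * q →
      κ₁ ≤ empNorm (fun i => linForm b δ (X i ω)) / l2Norm δ ∧
      empNorm (fun i => linForm b δ (X i ω)) / l2Norm δ ≤ κ₂}ᶜ +
    ENNReal.ofReal (2 * (2 * (R / ε) + 5) / n) := by
  have hne : ∀ t u (δ : Fin p → ℝ), restrictTo (S t u) δ ≠ 0 → ∃ j : Fin p, j ∈ S t u := by
    intro t u δ h
    by_contra! hcon
    refine h (funext fun j => ?_)
    simp [restrictTo_apply, hcon j]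
  -- If `s = 0` or `p = 0`, no `δ` has `δ_S ≠ 0`, and the event is the whole space.
  by_cases hsp : 0 < s ∧ 0 < p
  swap
  · have huniv : {ω | ∀ t ∈ 𝒯, ∀ u ∈ 𝒰, ∀ δ ∈ cone c (S t u), restrictTo (S t u) δ ≠ 0 →
        κ₁ * √C / 4 ≤ empNorm (fun i => linForm b δ (X i ω) * √(K ((T i ω - t) / h))) /
          (l2Norm (restrictTo (S t u) δ) * √h)} = Set.univ := by
      refine Set.eq_univ_of_forall fun ω t ht u hu δ _ hδS => ?_
      obtain ⟨j, hj⟩ := hne t u δ hδS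
      exact absurd ⟨(Finset.card_pos.2 ⟨j, hj⟩).trans_le (hS t ht u hu),
        (Nat.zero_le _).trans_lt j.2⟩ hsp
    rw [huniv]
    simp
  obtain ⟨hs, hp⟩ := hsp
  have hζ : 0 < ζ ^ 2 := hC0.trans_le (hb.le_sq ⟨0, hp⟩)
  have hs0 : (0 : ℝ) < s := by exact_mod_cast hs
  have hs1 : (1 : ℝ) ≤ s := by exact_mod_cast hs
  have hd : 0 < ε * h := by positivity
  set A := (B + 1 / C) / C ^ 2 with hAdef
  have hA : 0 < A := by positivity
  set G := gridIndices 𝒯 R (ε * h) with hG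
  set g : ℤ → 𝒳 → ℝ := fun k => condMean f (lowerWeight K ε h (k * (ε * h))) with hg
  set Bad : ℤ → Fin p → Fin p → Set Ω := fun k j l =>
    {ω | ¬ |(∑ i, b j (X i ω) * b l (X i ω) *
      (lowerWeight K ε h (k * (ε * h)) (T i ω) - g k (X i ω))) / n| ≤ η / s} with hBad
  have hgb : ∀ k ∈ G, ∀ᵐ x ∂P.fst, C / 2 ≤ g k x ∧ g k x ≤ 1 / C := by
    intro k hk
    obtain ⟨t, ht, hat⟩ := (mem_gridIndices.1 hk).2
    exact condMean_lowerWeight_mem_Icc hK hε hhalf hh hsupp hhr h𝒯' hthick hf.measurable hC0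
      hov ht hat
  have hgood : ∀ᵐ ω ∂μ, ∀ k ∈ G, ∀ i, C / 2 ≤ g k (X i ω) := by
    refine (Finset.eventually_all G).2 fun k hk => ae_all_iff.2 fun i => ?_
    have h1 : ∀ᵐ z ∂(μ.map fun ω => (X i ω, T i ω)), C / 2 ≤ g k z.1 := by
      rw [hiid.law i]
      exact ae_fst ((hgb k hk).mono fun x hx => hx.1)
    exact ae_of_ae_map ((hiid.measurable_X i).prodMk (hiid.measurable_T i)).aemeasurable h1
  -- The weights are at most `B / h`, so `V = A * ζ ^ 2 / h` is admissible; since `n * h ≥ 1`, the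
  -- grid has `O(n)` points.
  have hbad : μ.real (⋃ k ∈ G, ⋃ j, ⋃ l, Bad k j l) ≤ 2 * (2 * (R / ε) + 5) / n := by
    refine (measureReal_iUnion_three_le G Bad
      (a := 2 * Real.exp (-(n * (η / s) ^ 2 / (4 * (A * ζ ^ 2 / h))))) ?_).trans ?_
    · intro k hk j l
      refine measureReal_gram_deviation_le hiid hf hC0 hC1 hb (measurable_lowerWeight hK hε _)
        (lowerWeight_nonneg hK hh _) (B := B / h) (fun τ => ?_)
        ((hgb k hk).mono fun x hx => ⟨(half_pos hC0).le.trans hx.1, hx.2⟩)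
        (by positivity) ?_ (by positivity) ?_ j l
      · refine div_le_div_of_nonneg_right ?_ hh.le
        exact (localInf_le hK.nonneg (Metric.mem_ball_self hε)).trans (hB _)
      · have h1 : B / h + 1 / C ≤ (B + 1 / C) / h := by
          rw [add_div]
          exact add_le_add_right (le_div_self (by positivity) hh hh1) _
        calc ζ ^ 2 * (B / h + 1 / C) / C ^ 2 ≤ ζ ^ 2 * ((B + 1 / C) / h) / C ^ 2 := by gcongr
          _ = A * ζ ^ 2 / h := by rw [hAdef]; field_simp
      · rw [div_le_one hs0]; linarith
    · refine card_mul_tail_le (h := h) (ζ := ζ) hn hA hη0 (by positivity) hs hh hζ rfl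
        hrate ?_
      have h1 : 1 ≤ n * h := hnh hs hp
      calc (G.card : ℝ) ≤ 2 * (R / (ε * h)) + 5 := card_gridIndices_le hR0 hd
        _ ≤ (2 * (R / (ε * h)) + 5 / h) := by
            gcongr; exact le_div_self (by norm_num) hh hh1
        _ = (2 * (R / ε) + 5) * (1 / h) := by field_simp
        _ ≤ (2 * (R / ε) + 5) * n := by
            gcongr
            rwa [div_le_iff₀ hh]
  set Eig : Set Ω := {ω | ∀ δ : Fin p → ℝ, δ ≠ 0 → (hammingNorm δ : ℝ) ≤ s * q →
      κ₁ ≤ empNorm (fun i => linForm b δ (X i ω)) / l2Norm δ ∧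
      empNorm (fun i => linForm b δ (X i ω)) / l2Norm δ ≤ κ₂} with hEig
  calc _ ≤ μ (Eigᶜ ∪ ⋃ k ∈ G, ⋃ j, ⋃ l, Bad k j l) := by
        -- The inclusion holds only almost surely, because of the lower bound on `g k` at the sample
        -- points.
        refine measure_mono_ae ?_
        filter_upwards [hgood] with ω hω hcompl
        by_contra hcon
        refine hcompl fun t ht u hu δ hδ hδS => ?_
        have hcon' : ω ∉ Eigᶜ ∪ ⋃ k ∈ G, ⋃ j, ⋃ l, Bad k j l := hcon
        rw [Set.mem_union, not_or, Set.notMem_compl_iff] at hcon'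
        obtain ⟨hE, hnb⟩ := hcon'
        simp only [Set.mem_iUnion, not_exists] at hnb
        obtain ⟨k, hk, hkt⟩ := exists_mem_gridIndices hd hR ht
        refine weighted_empNorm_ge b (fun i => X i ω) (s := s) (τ := η / s) hκ₁ hC0 hh
          (S t u) (hS t ht u hu) δ hδ hδS
          (empNorm_ge_of_sparse b (fun i => X i ω) hs hL hκ₁ hLq hL' hE (S t u)
            (hS t ht u hu) δ hδ)
          (fun i => K ((T i ω - t) / h)) (fun i => lowerWeight K ε h (k * (ε * h)) (T i ω))
          (fun i => g k (X i ω)) (fun i => hK.nonneg _) (fun i => lowerWeight_le hK hh hkt _)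
          (hω k hk) (by positivity) ?_ ?_
        · calc η / s * ((1 + |c|) ^ 2 * s) = η * (1 + |c|) ^ 2 := by field_simp
            _ ≤ _ := hη
        · intro j l
          have := hnb k hk j l
          simpa only [hBad, Set.mem_ofPred_eq, not_not] using this
    _ ≤ μ Eigᶜ + μ (⋃ k ∈ G, ⋃ j, ⋃ l, Bad k j l) := measure_union_le _ _
    _ ≤ _ := by
        gcongr
        rw [← ofReal_measureReal (measure_ne_top _ _)]
        exact ENNReal.ofReal_le_ofReal hbad

theorem mainTheorem8
    {Ω 𝒳 : ℕ → Type*} [∀ n, MeasurableSpace (Ω n)] [∀ n, MeasurableSpace (𝒳 n)]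
    (μ : ∀ n, Measure (Ω n)) [∀ n, IsProbabilityMeasure (μ n)]
    -- the law of `(X, T)`, and the i.i.d. sample of size `n`
    (P : ∀ n, Measure (𝒳 n × ℝ)) [∀ n, IsProbabilityMeasure (P n)]
    (X : ∀ n, Fin n → Ω n → 𝒳 n) (T : ∀ n, Fin n → Ω n → ℝ)
    (hiid : ∀ n, IsIIDSample (μ n) (P n) (X n) (T n))
    -- kernel and bandwidth
    (K : ℝ → ℝ) (hK : IsSymmKernel K)
    (h : ℕ → ℝ) (hpos : ∀ n, 0 < h n) (hzero : Tendsto h atTop (𝓝 0))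
    -- index sets, conditional density of `T` given `X`, and overlap
    (𝒯 𝒯' 𝒰 : Set ℝ) (h𝒯 : IsCompact 𝒯) (h𝒯' : IsCompact 𝒯') (hsub : 𝒯 ⊆ interior 𝒯')
    (C : ℝ) (hC0 : 0 < C) (hC1 : C < 1)
    (f : ∀ n, ℝ → 𝒳 n → ℝ) (hf : ∀ n, IsCondDensity (P n) (f n))
    (hoverlap : ∀ n, ∀ t ∈ 𝒯', ∀ᵐ x ∂(P n).fst, C ≤ f n t x ∧ f n t x ≤ 1 / C)
    -- basis functions, sparsity, and rates
    (p s : ℕ → ℕ) (ζ ℓ : ℕ → ℝ) (b : ∀ n, Fin (p n) → 𝒳 n → ℝ)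
    (hb : ∀ n, BasisBounds (P n).fst (b n) (ζ n) C)
    (hℓ : Tendsto ℓ atTop atTop)
    (hrate : Tendsto (fun n => ζ n ^ 2 * (s n : ℝ) ^ 2 * ℓ n ^ 2 *
      Real.log (max (p n : ℝ) (n : ℝ)) / ((n : ℝ) * h n)) atTop (𝓝 0))
    -- sparse eigenvalues
    (κ₁ κ₂ : ℝ) (hκ₁ : 0 < κ₁) (heig : SparseEigenvalueCondition μ p s b X κ₁ κ₂)
    -- the sets defining the cones
    (S : ∀ n, ℝ → ℝ → Finset (Fin (p n)))
    (hS : ∀ n, ∀ t ∈ 𝒯, ∀ u ∈ 𝒰, (S n t u).card ≤ s n) (c : ℝ) :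
    0 < κ₁ * √C / 4 ∧
    WPA1 μ (fun n => {ω | ∀ t ∈ 𝒯, ∀ u ∈ 𝒰, ∀ δ ∈ cone c (S n t u),
      restrictTo (S n t u) δ ≠ 0 →
        κ₁ * √C / 4 ≤
          empNorm (fun i => linForm (b n) δ (X n i ω) * √(K ((T n i ω - t) / h n))) /
            (l2Norm (restrictTo (S n t u) δ) * √(h n))}) := by
  refine ⟨by positivity, ?_⟩
  obtain ⟨B, hB0, hB⟩ := hK.bounded
  obtain ⟨ε, hε, hhalf⟩ := exists_half_le_integral_localInf hK
  obtain ⟨R₀, hR₀⟩ : ∃ R₀, ∀ v, K v ≠ 0 → |v| ≤ R₀ := by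
    obtain ⟨R₀, h⟩ := hK.compactSupport.isCompact.isBounded.exists_norm_le
    exact ⟨R₀, fun v hv => h v (subset_tsupport K hv)⟩
  obtain ⟨R, hR⟩ := h𝒯.isBounded.exists_norm_le
  obtain ⟨r, hr, hthick⟩ := h𝒯.exists_cthickening_subset_open isOpen_interior hsub
  obtain ⟨q, hq, heig⟩ := heig
  obtain ⟨L, hL⟩ := exists_nat_gt ((max κ₂ 0 * |c| / (κ₁ / 2)) ^ 2)
  have hL0 : 0 < L := by
    have : (0 : ℝ) < L := (sq_nonneg _).trans_lt hL
    exact_mod_cast this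
  have hL' : max κ₂ 0 * |c| ≤ κ₁ / 2 * √L := by
    rw [← div_le_iff₀' (half_pos hκ₁)]
    exact Real.le_sqrt_of_sq_le hL.le
  set η := min 1 (κ₁ ^ 2 * C / 16 / (1 + |c|) ^ 2) with hηdef
  have hη0 : 0 < η := lt_min one_pos (by positivity)
  have hη : η * (1 + |c|) ^ 2 ≤ κ₁ ^ 2 * C / 16 :=
    (le_div_iff₀ (by positivity)).1 (min_le_right _ _)
  have hn0 : ∀ᶠ n : ℕ in atTop, 3 ≤ n := eventually_ge_atTop 3
  -- Eventually `ℓ n ≥ 1`, so the factor `ℓ n ^ 2` may be dropped.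
  have hrate' : ∀ a > 0, ∀ᶠ n : ℕ in atTop,
      ζ n ^ 2 * (s n : ℝ) ^ 2 * Real.log (max (p n : ℝ) (n : ℝ)) ≤ a * (n * h n) := by
    intro a ha
    filter_upwards [hn0, hrate.eventually (ge_mem_nhds ha), hℓ.eventually_ge_atTop 1]
      with n hn hlt hl
    have hn' : (0 : ℝ) < n := by exact_mod_cast (by omega : 0 < n)
    have hlog : 0 ≤ Real.log (max (p n : ℝ) (n : ℝ)) :=
      Real.log_nonneg (le_max_of_le_right (by exact_mod_cast (by omega : 1 ≤ n)))
    rw [div_le_iff₀ (mul_pos hn' (hpos n))] at hlt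
    refine le_trans ?_ hlt
    have h1 : 1 ≤ ℓ n ^ 2 := one_le_pow₀ hl
    calc ζ n ^ 2 * (s n : ℝ) ^ 2 * Real.log (max (p n : ℝ) (n : ℝ))
        = ζ n ^ 2 * (s n : ℝ) ^ 2 * 1 * Real.log (max (p n : ℝ) (n : ℝ)) := by ring
      _ ≤ _ := by gcongr
  have hh0 : ∀ᶠ n in atTop, h n ≤ 1 := hzero.eventually (ge_mem_nhds one_pos)
  have hhr : ∀ᶠ n in atTop, (R₀ + ε) * h n ≤ r := by
    have h1 : Tendsto (fun n => (R₀ + ε) * h n) atTop (𝓝 0) := by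
      simpa using hzero.const_mul (R₀ + ε)
    exact h1.eventually (ge_mem_nhds hr)
  -- `R` may be negative when `𝒯` is empty, hence `|R|`.
  have hrem : Tendsto (fun n : ℕ => ENNReal.ofReal (2 * (2 * (|R| / ε) + 5) / n)) atTop
      (𝓝 0) := by
    have h1 := tendsto_const_div_atTop_nhds_zero_nat (2 * (2 * (|R| / ε) + 5))
    simpa using ENNReal.tendsto_ofReal h1
  have hlim := heig.add hrem
  rw [add_zero] at hlim
  refine tendsto_of_tendsto_of_tendsto_of_le_of_le' tendsto_const_nhds hlim
    (Eventually.of_forall fun _ => zero_le) ?_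
  filter_upwards [hn0, hrate' C hC0,
    hrate' (η ^ 2 / (16 * ((B + 1 / C) / C ^ 2))) (by positivity), hh0, hhr,
    hq.eventually_ge_atTop (L + 1 : ℝ)] with n hn hrC hrη hhn hhrn hqn
  -- The rate bound with constant `C` reads `C ≤ C * (n * h n)`, since `ζ n ^ 2 ≥ C`, `s n ≥ 1`, and
  -- the logarithm is at least one for `n ≥ 3 > e`.
  have hnh : 0 < s n → 0 < p n → 1 ≤ n * h n := by
    intro hs hp
    have h1 : C ≤ ζ n ^ 2 := (hb n).le_sq ⟨0, hp⟩
    have h2 : (1 : ℝ) ≤ (s n : ℝ) ^ 2 := one_le_pow₀ (by exact_mod_cast hs)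
    have h3 : 1 ≤ Real.log (max (p n : ℝ) (n : ℝ)) := by
      rw [Real.le_log_iff_exp_le
        (lt_max_of_lt_right (by exact_mod_cast (by omega : 0 < n)))]
      refine le_max_of_le_right (Real.exp_one_lt_three.le.trans ?_)
      exact_mod_cast hn
    have h4 : C * 1 * 1 ≤ C * (n * h n) :=
      le_trans (by gcongr) hrC
    rw [mul_one, mul_one] at h4
    exact le_of_mul_le_mul_left (by linarith) hC0
  exact measure_local_compatibility_compl_le (hiid n) hK hB0 (fun u => (hB u).1) hε hhalf hR₀
    h𝒯'.measurableSet (hthick.trans interior_subset) (abs_nonneg R)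
    (fun t ht => (hR t ht).trans (le_abs_self R)) hC0 hC1 (hf n) (hoverlap n) (hb n) hκ₁
    (hS n) hL0 hqn hL' hη0 (min_le_left _ _) hη (hpos n) hhn hhrn (by omega) hnh hrη
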